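/- Let $\mathfrak g$ be a finite-dimensional simple complex Lie algebra with a Cartan subalgebra $\mathfrak t$, a choice of simple roots and a nonzero root vector $E_i$ for each simple root. Let $\sigma\in\operatorname{Aut}(\mathfrak g)$ preserve $\mathfrak t$ and permute the $E_i$, let $e$ be its order, and let $x\in\mathfrak t$ be fixed by $\sigma$ with $\alpha(x)\in\mathbb R$ for all roots $\alpha$. Let $\theta=\exp(x)\rtimes\sigma$, that is, $\theta=\operatorname{Ad}(\exp x)\circ\sigma$, where $\operatorname{Ad}(\exp x)$ is the identity on $\mathfrak t$ and multiplication by $e^{2\pi i\alpha(x)}$ on the root space $\mathfrak g_\alpha$. Assume that $\theta$ has finite order $m$. Put $\xi_n=e^{2\pi i/n}$, $\mathfrak g_i=\{v:\theta(v)=\xi_m^i v\}$, $\check\lambda=mx$ and $\mathfrak g(k)=\{v:[\check\lambda,v]=kv\}$ for $k\in\mathbb Z$; then $e\mid m$ and $\mathfrak g=\bigoplus_{k\in\mathbb Z}\mathfrak g(k)$. Let $${}^\sigma\tilde{\mathfrak g}=\Big\{\sum_i t^i\otimes v_i\in\mathfrak g[t,t^{-1}]:\ \sigma(v_i)=\xi_e^i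 v_i\ \text{for all } i\Big\},\qquad \mathfrak g(\theta,m)=\bigoplus_{i\in\mathbb Z}u^i\mathfrak g_i\subset\mathfrak g[u,u^{-1}],$$ and view $\mathfrak g[t,t^{-1}]\subset\mathfrak g[u,u^{-1}]$ via $t=u^{m/e}$. The automorphism $\operatorname{Ad}(\check\lambda(u^{-1}))$ of $\mathfrak g[u,u^{-1}]$, $u^i\otimes v\mapsto u^{i-k}\otimes v$ for $v\in\mathfrak g(k)$, restricts to an isomorphism $\Phi:\mathfrak g(\theta,m)\to{}^\sigma\tilde{\mathfrak g}$. Let $\langle\,,\rangle_\sigma$ be the invariant form on ${}^\sigma\tilde{\mathfrak g}$ with $\langle t^i\otimes v,t^j\otimes w\rangle_\sigma=\delta_{i,-j}(v,w)_{Kill}$. For $i\in\mathbb Z$, the degree $i$ piece ${}^\sigma\tilde{\mathfrak g}_{x,i}$ of the Kac–Moy–Prasad grading is the sum of the weight spaces of ${}^\sigma\tilde{\mathfrak g}$ for $\mathfrak t^\sigma$ and $t\partial_t$ whose weights $(\beta,n)\in(\mathfrak t^\sigma)^*\times\mathbb Z$ satisfy $\beta(x)+\frac ne=\frac im$. Let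 $X\in\mathfrak g_1$ be regular semisimple ($\operatorname{ad}X$ is semisimple and the centralizer of $X$ is a Cartan subalgebra), and let $p_1=\Phi(uX)$, $\mathfrak a=\operatorname{Ker}(\operatorname{ad}p_1)$, $\mathfrak c=\operatorname{Im}(\operatorname{ad}p_1)$ in ${}^\sigma\tilde{\mathfrak g}$. Then: 1. ${}^\sigma\tilde{\mathfrak g}=\mathfrak a\oplus\mathfrak c$, and this decomposition is orthogonal with respect to $\langle\,,\rangle_\sigma$. 2. The Lie subalgebra $\mathfrak a$ is commutative. With $\mathfrak a_i=\mathfrak a\cap{}^\sigma\tilde{\mathfrak g}_{x,i}$ one has $\mathfrak a=\bigoplus_{i\in\mathbb Z}\mathfrak a_i$; the subspaces $\mathfrak a_i$ and $\mathfrak a_j$ are orthogonal with respect to $\langle\,,\rangle_\sigma$ if $i+j\ne0$ and nondegenerately paired if $i+j=0$. 3. Let ${}^\sigma\tilde{\mathfrak g}\oplus\mathbb CK$ be the Kac–Moody central extension, in which $K$ is central and $[t^i\otimes v,t^j\otimes w]=t^{i+j}\otimes[v,w]+i\,\delta_{i,-j}(v,w)_{Kill}K$. The preimage $\hat{\mathfrak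 a}=\mathfrak a\oplus\mathbb CK$ of $\mathfrak a$ in it is a central extension of $\mathfrak a$ by $\mathbb CK$ which does not split (the projection $\hat{\mathfrak a}\to\mathfrak a$ has no section that is a Lie algebra homomorphism). -/

import Mathlib

noncomputable section

open scoped TensorProduct

namespace KacLoop

/-- A linear map is compatible with brackets if it is so on a spanning set. -/
theorem map_lie_of_span {L M : Type*} [LieRing L] [LieAlgebra ℂ L] [LieRing M] [LieAlgebra ℂ M]
    {S : Set L} (hS : Submodule.span ℂ S = ⊤) (p : L →ₗ[ℂ] M)
    (h : ∀ a ∈ S, ∀ b ∈ S, p ⁅a, b⁆ = ⁅p a, p b⁆) (a b : L) : p ⁅a, b⁆ = ⁅p a, p b⁆ := by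
  have ha : a ∈ Submodule.span ℂ S := hS ▸ Submodule.mem_top
  have hb : b ∈ Submodule.span ℂ S := hS ▸ Submodule.mem_top
  induction ha, hb using Submodule.span_induction₂ with
  | mem_mem a b ha hb => exact h a ha b hb
  | zero_left b hb => simp
  | zero_right a ha => simp
  | add_left a b c _ _ _ h₁ h₂ => simp [h₁, h₂]
  | add_right a b c _ _ _ h₁ h₂ => simp [h₁, h₂]
  | smul_left r a b _ _ h₁ => simp [h₁]
  | smul_right r a b _ _ h₁ => simp [h₁]

/-- The loop algebra `𝔤[t, t⁻¹]`. -/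
abbrev Loop (𝔤 : Type*) [LieRing 𝔤] [LieAlgebra ℂ 𝔤] : Type _ := LieAlgebra.loopAlgebra ℂ ℤ 𝔤

section Loop

variable {𝔤 : Type*} [LieRing 𝔤] [LieAlgebra ℂ 𝔤]

/-- The monomial `tⁱ ⊗ v`. -/
def mono (i : ℤ) : 𝔤 →ₗ[ℂ] Loop 𝔤 :=
  TensorProduct.mk ℂ (AddMonoidAlgebra ℂ ℤ) 𝔤 (AddMonoidAlgebra.single i 1)

/-- The coefficient `fᵢ` of `f = ∑ tⁱ ⊗ fᵢ`. -/
def coeff (i : ℤ) : Loop 𝔤 →ₗ[ℂ] 𝔤 :=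
  Finsupp.lapply i ∘ₗ (LieAlgebra.LoopAlgebra.toFinsupp ℂ ℤ 𝔤).toLinearMap

theorem coeff_mono (i j : ℤ) (v : 𝔤) : coeff j (mono i v) = if i = j then v else 0 := by
  classical
  simp only [coeff, mono, LinearMap.comp_apply, TensorProduct.mk_apply, LinearEquiv.coe_coe,
    LieAlgebra.LoopAlgebra.toFinsupp_single_tmul, Finsupp.lapply_apply, Finsupp.single_apply]

theorem lie_mono (i j : ℤ) (v w : 𝔤) : ⁅mono i v, mono j w⁆ = mono (i + j) ⁅v, w⁆ := by
  simp only [mono, TensorProduct.mk_apply, LieAlgebra.ExtendScalars.bracket_tmul,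
    AddMonoidAlgebra.single_mul_single, mul_one]

theorem eq_sum_mono (f : Loop 𝔤) :
    f = ∑ i ∈ (LieAlgebra.LoopAlgebra.toFinsupp ℂ ℤ 𝔤 f).support, mono i (coeff i f) := by
  apply (LieAlgebra.LoopAlgebra.toFinsupp ℂ ℤ 𝔤).injective
  rw [map_sum]
  simp only [mono, TensorProduct.mk_apply, LieAlgebra.LoopAlgebra.toFinsupp_single_tmul, coeff]
  exact (Finsupp.sum_single _).symm

theorem ext_coeff {f g : Loop 𝔤} (h : ∀ i, coeff i f = coeff i g) : f = g := by
  apply (LieAlgebra.LoopAlgebra.toFinsupp ℂ ℤ 𝔤).injective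
  ext i
  exact h i

theorem loop_induction {ι : Type*} {W : ι → Submodule ℂ 𝔤} (hW : ⨆ k, W k = ⊤)
    {P : Loop 𝔤 → Prop} (h0 : P 0) (hadd : ∀ f g, P f → P g → P (f + g))
    (hm : ∀ (i : ℤ) (k : ι), ∀ v ∈ W k, P (mono i v)) (f : Loop 𝔤) : P f := by
  rw [eq_sum_mono f]
  refine Finset.sum_induction _ P hadd h0 fun i _ => ?_
  refine Submodule.iSup_induction W (motive := fun v => P (mono i v))
    (hW ▸ Submodule.mem_top : coeff i f ∈ ⨆ k, W k) (hm i) ?_ ?_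
  · rw [map_zero]; exact h0
  · intro v w hv hw
    rw [map_add]; exact hadd _ _ hv hw

/-- For a family `V` of subspaces with `[V i, V j] ⊆ V (i + j)`, the subalgebra
`⨁ i, tⁱ ⊗ V i` of the loop algebra. -/
def loopSub (V : ℤ → Submodule ℂ 𝔤)
    (hV : ∀ i j : ℤ, ∀ v ∈ V i, ∀ w ∈ V j, ⁅v, w⁆ ∈ V (i + j)) : LieSubalgebra ℂ (Loop 𝔤) where
  carrier := {f | ∀ i, coeff i f ∈ V i}
  add_mem' hf hg i := by
    rw [map_add]; exact (V i).add_mem (hf i) (hg i)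
  zero_mem' i := by
    rw [map_zero]; exact (V i).zero_mem
  smul_mem' c f hf i := by
    rw [map_smul]; exact (V i).smul_mem c (hf i)
  lie_mem' {f g} hf hg i := by
    rw [eq_sum_mono f, eq_sum_mono g, sum_lie, map_sum]
    refine (V i).sum_mem fun a _ => ?_
    rw [lie_sum, map_sum]
    refine (V i).sum_mem fun b _ => ?_
    rw [lie_mono, coeff_mono]
    split_ifs with h
    · subst h; exact hV _ _ _ (hf a) _ (hg b)
    · exact (V i).zero_mem

theorem mem_loopSub {V : ℤ → Submodule ℂ 𝔤} {hV} {f : Loop 𝔤} :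
    f ∈ loopSub V hV ↔ ∀ i, coeff i f ∈ V i := Iff.rfl

theorem mono_mem_loopSub {V : ℤ → Submodule ℂ 𝔤} {hV} {i : ℤ} {v : 𝔤} (hv : v ∈ V i) :
    mono i v ∈ loopSub V hV := by
  intro j
  rw [coeff_mono]
  split_ifs with h
  · subst h; exact hv
  · exact (V j).zero_mem

/-- The substitution `t ↦ u ^ N`. -/
def substLin (N : ℤ) : Loop 𝔤 →ₗ[ℂ] Loop 𝔤 :=
  LinearMap.rTensor 𝔤
    (AddMonoidAlgebra.mapDomainAlgHom ℂ ℂ (AddMonoidHom.mulLeft N : ℤ →+ ℤ)).toLinearMap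

theorem substLin_mono (N i : ℤ) (v : 𝔤) : substLin N (mono i v) = mono (N * i) v := by
  simp only [substLin, mono, TensorProduct.mk_apply, LinearMap.rTensor_tmul,
    AlgHom.toLinearMap_apply, AddMonoidAlgebra.mapDomainAlgHom_apply,
    AddMonoidAlgebra.mapDomain_single, AddMonoidHom.coe_mulLeft]

theorem span_mono {ι : Type*} {W : ι → Submodule ℂ 𝔤} (hW : ⨆ k, W k = ⊤) :
    Submodule.span ℂ {f : Loop 𝔤 | ∃ i k, ∃ v ∈ W k, f = mono i v} = ⊤ := by
  refine Submodule.eq_top_iff'.2 fun f => loop_induction hW (Submodule.zero_mem _)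
    (fun f g hf hg => Submodule.add_mem _ hf hg) (fun i k v hv => ?_) f
  exact Submodule.subset_span ⟨i, k, v, hv, rfl⟩

/-- It is enough to check bracket compatibility on monomials `tⁱ ⊗ v`, `v` in a spanning family. -/
theorem map_lie_of_mono {ι : Type*} {W : ι → Submodule ℂ 𝔤} (hW : ⨆ k, W k = ⊤)
    (p : Loop 𝔤 →ₗ[ℂ] Loop 𝔤)
    (h : ∀ i j : ℤ, ∀ k l, ∀ v ∈ W k, ∀ w ∈ W l,
      p ⁅mono i v, mono j w⁆ = ⁅p (mono i v), p (mono j w)⁆) (f g : Loop 𝔤) :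
    p ⁅f, g⁆ = ⁅p f, p g⁆ := by
  refine map_lie_of_span (span_mono hW) p ?_ f g
  rintro _ ⟨i, k, v, hv, rfl⟩ _ ⟨j, l, w, hw, rfl⟩
  exact h i j k l v hv w hw

/-- The substitution homomorphism `𝔤[t, t⁻¹] → 𝔤[u, u⁻¹]`, `t ↦ u ^ N`. -/
def subst (N : ℤ) : Loop 𝔤 →ₗ⁅ℂ⁆ Loop 𝔤 where
  toLinearMap := substLin N
  map_lie' {f g} := by
    refine map_lie_of_mono (W := fun _ : Unit => ⊤) (by simp) (substLin N) ?_ f g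
    intro i j _ _ v _ w _
    rw [lie_mono, substLin_mono, substLin_mono, substLin_mono, lie_mono, mul_add]

theorem subst_mono (N i : ℤ) (v : 𝔤) : subst N (mono i v) = mono (N * i) v := substLin_mono N i v

theorem subst_injective {N : ℤ} (hN : N ≠ 0) :
    Function.Injective (subst N : Loop 𝔤 →ₗ⁅ℂ⁆ Loop 𝔤) := by
  apply Module.Flat.rTensor_preserves_injective_linearMap
  exact AddMonoidAlgebra.mapDomain_injective (mul_right_injective₀ hN)

/-- The bilinear form with `⟨tⁱ ⊗ x, tʲ ⊗ y⟩ = δ_{i,-j} κ(x, y)`, `κ` the Killing form. -/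
def loopForm : LinearMap.BilinForm ℂ (Loop 𝔤) :=
  (Finsupp.lsum ℂ fun i : ℤ => (killingForm ℂ 𝔤).compl₂ (coeff (-i))) ∘ₗ
    (LieAlgebra.LoopAlgebra.toFinsupp ℂ ℤ 𝔤).toLinearMap

theorem loopForm_mono (i j : ℤ) (v w : 𝔤) :
    loopForm (mono i v) (mono j w) = if i + j = 0 then killingForm ℂ 𝔤 v w else 0 := by
  have : loopForm (mono i v) (mono j w) = killingForm ℂ 𝔤 v (coeff (-i) (mono j w)) := by
    simp only [loopForm, mono, LinearMap.comp_apply, TensorProduct.mk_apply, LinearEquiv.coe_coe,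
      LieAlgebra.LoopAlgebra.toFinsupp_single_tmul, Finsupp.lsum_single, LinearMap.compl₂_apply]
  rw [this, coeff_mono]
  by_cases h : i + j = 0
  · rw [if_pos h, if_pos (by omega)]
  · rw [if_neg h, if_neg (by omega), map_zero]

end Loop

section Cocharacter

variable {𝔤 : Type*} [LieRing 𝔤] [LieAlgebra ℂ 𝔤]

/-- `𝔤(k)`: the eigenspace of `ad H` for the integer eigenvalue `k`. -/
def gr (H : 𝔤) (k : ℤ) : Submodule ℂ 𝔤 :=
  Module.End.eigenspace (LieAlgebra.ad ℂ 𝔤 H) (k : ℂ)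

theorem mem_gr {H : 𝔤} {k : ℤ} {v : 𝔤} : v ∈ gr H k ↔ ⁅H, v⁆ = (k : ℂ) • v := by
  rw [gr, Module.End.mem_eigenspace_iff, LieAlgebra.ad_apply]

theorem lie_mem_gr {H : 𝔤} {k l : ℤ} {v w : 𝔤} (hv : v ∈ gr H k) (hw : w ∈ gr H l) :
    ⁅v, w⁆ ∈ gr H (k + l) := by
  rw [mem_gr] at *
  rw [leibniz_lie, hv, hw, smul_lie, lie_smul, ← add_smul]
  push_cast
  rfl

theorem gr_internal {H : 𝔤} (hH : ⨆ k, gr H k = ⊤) : DirectSum.IsInternal (gr H) := by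
  refine DirectSum.isInternal_submodule_of_iSupIndep_of_iSup_eq_top ?_ hH
  exact (LieAlgebra.ad ℂ 𝔤 H).eigenspaces_iSupIndep.comp (f := fun k : ℤ => (k : ℂ))
    Int.cast_injective

/-- The linear map on `𝔤 = ⨁ k, 𝔤(k)` glued from its restrictions to the summands. -/
def glue {H : 𝔤} (hH : ⨆ k, gr H k = ⊤) {M : Type*} [AddCommGroup M] [Module ℂ M]
    (p : ∀ k, gr H k →ₗ[ℂ] M) : 𝔤 →ₗ[ℂ] M :=
  DirectSum.toModule ℂ ℤ M p ∘ₗ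
    (LinearEquiv.ofBijective (DirectSum.coeLinearMap (gr H)) (gr_internal hH)).symm.toLinearMap

theorem glue_apply {H : 𝔤} (hH : ⨆ k, gr H k = ⊤) {M : Type*} [AddCommGroup M] [Module ℂ M]
    (p : ∀ k, gr H k →ₗ[ℂ] M) {k : ℤ} {v : 𝔤} (hv : v ∈ gr H k) :
    glue hH p v = p k ⟨v, hv⟩ := by
  have : (LinearEquiv.ofBijective (DirectSum.coeLinearMap (gr H)) (gr_internal hH)).symm v
      = DirectSum.lof ℂ ℤ (fun k => gr H k) k ⟨v, hv⟩ := by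
    rw [LinearEquiv.symm_apply_eq]
    exact (DirectSum.coeLinearMap_lof (gr H) k ⟨v, hv⟩).symm
  simp only [glue, LinearMap.comp_apply, LinearEquiv.coe_coe, this, DirectSum.toModule_lof]

/-- The linear map `uⁱ ⊗ v ↦ u ^ (i + ε k) ⊗ v` for `v ∈ 𝔤(k)`. -/
def shiftLin {H : 𝔤} (hH : ⨆ k, gr H k = ⊤) (ε : ℤ) : Loop 𝔤 →ₗ[ℂ] Loop 𝔤 :=
  (Finsupp.lsum ℂ fun i : ℤ => glue hH fun k => mono (i + ε * k) ∘ₗ (gr H k).subtype) ∘ₗ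
    (LieAlgebra.LoopAlgebra.toFinsupp ℂ ℤ 𝔤).toLinearMap

theorem shiftLin_mono {H : 𝔤} (hH : ⨆ k, gr H k = ⊤) (ε i : ℤ) {k : ℤ} {v : 𝔤}
    (hv : v ∈ gr H k) : shiftLin hH ε (mono i v) = mono (i + ε * k) v := by
  have : shiftLin hH ε (mono i v)
      = glue hH (fun k => mono (i + ε * k) ∘ₗ (gr H k).subtype) v := by
    simp only [shiftLin, mono, LinearMap.comp_apply, TensorProduct.mk_apply, LinearEquiv.coe_coe,
      LieAlgebra.LoopAlgebra.toFinsupp_single_tmul, Finsupp.lsum_single]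
  rw [this, glue_apply hH _ hv]
  rfl

/-- `Ad(H(u ^ ε))` on `𝔤[u, u⁻¹]`, where `H` is viewed as a cocharacter: multiplication by
`u ^ (ε k)` on `𝔤(k)[u, u⁻¹]`. -/
def adCochar {H : 𝔤} (hH : ⨆ k, gr H k = ⊤) (ε : ℤ) : Loop 𝔤 →ₗ⁅ℂ⁆ Loop 𝔤 where
  toLinearMap := shiftLin hH ε
  map_lie' {f g} := by
    refine map_lie_of_mono hH (shiftLin hH ε) ?_ f g
    intro i j k l v hv w hw
    rw [lie_mono, shiftLin_mono hH ε _ (lie_mem_gr hv hw), shiftLin_mono hH ε _ hv,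
      shiftLin_mono hH ε _ hw, lie_mono]
    congr 1
    ring_nf

theorem adCochar_mono {H : 𝔤} (hH : ⨆ k, gr H k = ⊤) (ε i : ℤ) {k : ℤ} {v : 𝔤}
    (hv : v ∈ gr H k) : adCochar hH ε (mono i v) = mono (i + ε * k) v :=
  shiftLin_mono hH ε i hv

theorem adCochar_injective {H : 𝔤} (hH : ⨆ k, gr H k = ⊤) (ε : ℤ) :
    Function.Injective (adCochar hH ε) := by
  have : ∀ f, adCochar hH (-ε) (adCochar hH ε f) = f := by
    refine loop_induction hH ?_ ?_ ?_
    · rw [map_zero, map_zero]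
    · intro f g hf hg
      rw [map_add, map_add, hf, hg]
    · intro i k v hv
      rw [adCochar_mono hH ε i hv, adCochar_mono hH (-ε) _ hv]
      congr 1
      ring_nf
  exact Function.LeftInverse.injective this

/-- An eigenspace of an operator preserving the `𝔤(k)` is the sum of its intersections with them. -/
theorem eigenspace_le_iSup {H : 𝔤} (hH : ⨆ k, gr H k = ⊤) (A : Module.End ℂ 𝔤) (c : ℂ)
    (hA : ∀ k, ∀ v ∈ gr H k, A v ∈ gr H k) :
    A.eigenspace c ≤ ⨆ k, A.eigenspace c ⊓ gr H k := by
  classical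
  intro v hv
  rw [Module.End.mem_eigenspace_iff] at hv
  obtain ⟨d, rfl⟩ := (gr_internal hH).2 v
  change A (DirectSum.coeLinearMap (gr H) d) = c • DirectSum.coeLinearMap (gr H) d at hv
  let T := DirectSum.lmap (fun k => A.restrict (hA k))
  have hT : DirectSum.coeLinearMap (gr H) ∘ₗ T = A ∘ₗ DirectSum.coeLinearMap (gr H) := by
    ext k w
    simp [T]
  have h1 : T d = c • d := by
    refine (gr_internal hH).1 ?_
    change DirectSum.coeLinearMap (gr H) (T d) = DirectSum.coeLinearMap (gr H) (c • d)
    rw [map_smul, ← hv]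
    exact LinearMap.congr_fun hT d
  change DirectSum.coeLinearMap (gr H) d ∈ _
  rw [DirectSum.coeLinearMap_eq_dfinsuppSum]
  refine Submodule.sum_mem _ fun k _ => Submodule.mem_iSup_of_mem k ⟨?_, (d k).2⟩
  rw [SetLike.mem_coe, Module.End.mem_eigenspace_iff]
  have h2 := congrArg (fun z : DirectSum ℤ (fun k => gr H k) => ((z k : gr H k) : 𝔤)) h1
  exact h2

end Cocharacter

open LieAlgebra LieAlgebra.IsKilling

/-- A torsion automorphism `θ = exp(x) ⋊ σ` of a simple complex Lie algebra `𝔤`, relative to a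
Cartan subalgebra `𝔱`, a base of simple roots and a choice of simple root vectors `E i` (a pinning).
-/
structure TorsionAut (𝔤 : Type*) [LieRing 𝔤] [LieAlgebra ℂ 𝔤] [FiniteDimensional ℂ 𝔤]
    [LieAlgebra.IsSimple ℂ 𝔤] where
  /-- the Cartan subalgebra `𝔱` -/
  𝔱 : LieSubalgebra ℂ 𝔤
  [isCartan : 𝔱.IsCartanSubalgebra]
  /-- the simple roots -/
  base : (rootSystem 𝔱).Base
  /-- the simple root vectors -/
  E : base.support → 𝔤
  E_mem : ∀ i, E i ∈ rootSpace 𝔱 (i.1.1 : LieModule.Weight ℂ 𝔱 𝔤)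
  E_ne_zero : ∀ i, E i ≠ 0
  /-- the pinned (diagram) automorphism -/
  σ : 𝔤 ≃ₗ⁅ℂ⁆ 𝔤
  σ_mem : ∀ h ∈ 𝔱, σ h ∈ 𝔱
  σ_E : ∀ i, ∃ j, σ (E i) = E j
  /-- the point `x` of the real form `V` of `𝔱` on which all roots are real, fixed by `σ` -/
  x : 𝔱
  x_real : ∀ α : 𝔱.root, ((α : LieModule.Weight ℂ 𝔱 𝔤) x).im = 0
  σ_x : σ x = x
  /-- the automorphism `θ` -/
  θ : 𝔤 ≃ₗ⁅ℂ⁆ 𝔤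
  /-- `θ ∘ σ⁻¹` is `Ad(exp x)`: it acts on the root space of `α` by `exp(2πi α(x))`, and trivially
  on `𝔱`, the weight space of `α = 0`. -/
  θ_eq : ∀ α : LieModule.Weight ℂ 𝔱 𝔤, ∀ v ∈ rootSpace 𝔱 α,
    θ (σ.symm v) = Complex.exp (2 * Real.pi * Complex.I * α x) • v
  isOfFinOrder : IsOfFinOrder (θ.toLinearEquiv.toLinearMap : Module.End ℂ 𝔤)

namespace TorsionAut

attribute [instance] TorsionAut.isCartan

variable {𝔤 : Type*} [LieRing 𝔤] [LieAlgebra ℂ 𝔤] [FiniteDimensional ℂ 𝔤]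
  [LieAlgebra.IsSimple ℂ 𝔤] (D : TorsionAut 𝔤)

/-- `θ` as a linear endomorphism. -/
def θEnd : Module.End ℂ 𝔤 := D.θ.toLinearEquiv.toLinearMap

/-- `σ` as a linear endomorphism. -/
def σEnd : Module.End ℂ 𝔤 := D.σ.toLinearEquiv.toLinearMap

/-- The order `m` of `θ`. -/
def m : ℕ := orderOf D.θEnd

/-- The order `e` of `σ`. -/
def e : ℕ := orderOf D.σEnd

theorem m_pos : 0 < D.m := D.isOfFinOrder.orderOf_pos

theorem m_ne_zero : (D.m : ℂ) ≠ 0 := Nat.cast_ne_zero.2 D.m_pos.ne'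

/-- The root of unity `ξₙ = exp(2πi/n)`. -/
def ξ (n : ℕ) : ℂ := Complex.exp (2 * Real.pi * Complex.I / n)

theorem ξ_ne_zero (n : ℕ) : ξ n ≠ 0 := Complex.exp_ne_zero _

theorem ξ_zpow (n : ℕ) (k : ℤ) : ξ n ^ k = Complex.exp (k * (2 * Real.pi * Complex.I / n)) := by
  rw [ξ, Complex.exp_int_mul]

/-- The cocharacter `m x`. -/
def lam : 𝔤 := (D.m : ℂ) • (D.x : 𝔤)

theorem θ_apply_of_mem {α : LieModule.Weight ℂ D.𝔱 𝔤} {v : 𝔤} (hv : D.σ v ∈ rootSpace D.𝔱 α) :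
    D.θ v = Complex.exp (2 * Real.pi * Complex.I * α D.x) • D.σ v := by
  have := D.θ_eq α _ hv
  rwa [LieEquiv.symm_apply_apply] at this

theorem lie_x_of_mem {α : LieModule.Weight ℂ D.𝔱 𝔤} {v : 𝔤} (hv : v ∈ rootSpace D.𝔱 α) :
    ⁅(D.x : 𝔤), v⁆ = α D.x • v :=
  lie_eq_smul_of_mem_rootSpace hv D.x

theorem lie_x_σ {c : ℂ} {v : 𝔤} (hv : ⁅(D.x : 𝔤), v⁆ = c • v) :
    ⁅(D.x : 𝔤), D.σ v⁆ = c • D.σ v := by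
  conv_lhs => rw [← D.σ_x]
  rw [← LieEquiv.map_lie, hv, map_smul]

theorem θ_pow_E (i : D.base.support) (n : ℕ) : ∃ j : D.base.support,
    (j.1.1 : LieModule.Weight ℂ D.𝔱 𝔤) D.x = (i.1.1 : LieModule.Weight ℂ D.𝔱 𝔤) D.x ∧
    (D.θEnd ^ n) (D.E i) = Complex.exp (2 * Real.pi * Complex.I *
      (i.1.1 : LieModule.Weight ℂ D.𝔱 𝔤) D.x) ^ n • D.E j := by
  induction n with
  | zero => exact ⟨i, rfl, by simp⟩
  | succ n ih =>
    obtain ⟨j, hj, h⟩ := ih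
    obtain ⟨l, hl⟩ := D.σ_E j
    have h1 : (l.1.1 : LieModule.Weight ℂ D.𝔱 𝔤) D.x
        = (j.1.1 : LieModule.Weight ℂ D.𝔱 𝔤) D.x := by
      have := D.lie_x_σ (D.lie_x_of_mem (D.E_mem j))
      rw [hl, D.lie_x_of_mem (D.E_mem l)] at this
      exact smul_left_injective ℂ (D.E_ne_zero l) this
    refine ⟨l, h1.trans hj, ?_⟩
    rw [pow_succ', Module.End.mul_apply, h, map_smul, pow_succ, mul_smul]
    congr 1
    have : D.θEnd (D.E j) = D.θ (D.E j) := rfl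
    rw [this, D.θ_apply_of_mem (α := l.1.1) (hl ▸ D.E_mem l), hl, h1, hj]

theorem exp_eq_one_iff_int {z : ℂ} :
    Complex.exp (2 * Real.pi * Complex.I * z) = 1 ↔ ∃ k : ℤ, z = k := by
  rw [Complex.exp_eq_one_iff]
  have : (2 * Real.pi * Complex.I : ℂ) ≠ 0 := Complex.two_pi_I_ne_zero
  refine exists_congr fun k => ?_
  rw [mul_comm (k : ℂ)]
  exact mul_right_inj' this

theorem simple_int (i : D.base.support) :
    ∃ k : ℤ, (D.m : ℂ) * (i.1.1 : LieModule.Weight ℂ D.𝔱 𝔤) D.x = k := by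
  obtain ⟨j, -, h⟩ := D.θ_pow_E i D.m
  rw [show D.θEnd ^ D.m = 1 from pow_orderOf_eq_one _, Module.End.one_apply,
    ← Complex.exp_nat_mul] at h
  have hmem : D.E i ∈ rootSpace D.𝔱 (j.1.1 : LieModule.Weight ℂ D.𝔱 𝔤) := by
    rw [h]
    exact Submodule.smul_mem _ _ (D.E_mem j)
  have hw : (i.1.1 : LieModule.Weight ℂ D.𝔱 𝔤) = j.1.1 := by
    ext y
    have h1 := lie_eq_smul_of_mem_rootSpace (D.E_mem i) y
    have h2 := lie_eq_smul_of_mem_rootSpace hmem y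
    exact smul_left_injective ℂ (D.E_ne_zero i) (h1.symm.trans h2)
  have hij : i = j := Subtype.ext (Subtype.ext hw)
  subst hij
  rw [← exp_eq_one_iff_int]
  have : (1 : ℂ) • D.E i = _ := (one_smul ℂ (D.E i)).trans h
  refine Eq.trans ?_ (smul_left_injective ℂ (D.E_ne_zero i) this).symm
  congr 1
  ring

theorem weight_int (α : LieModule.Weight ℂ D.𝔱 𝔤) : ∃ k : ℤ, (D.m : ℂ) * α D.x = k := by
  by_cases hα : α.IsZero
  · exact ⟨0, by simp [show (α : D.𝔱 → ℂ) = 0 from hα]⟩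
  have hmem : α ∈ D.𝔱.root := by simpa using hα
  let P : AddSubgroup ℂ := (Int.castAddHom ℂ).range
  let φ : Module.Dual ℂ D.𝔱 →+ ℂ :=
    { toFun := fun f => (D.m : ℂ) * f D.x
      map_zero' := by simp
      map_add' := fun f g => by simp [mul_add] }
  have key : (rootSystem D.𝔱).root ⟨α, hmem⟩ ∈ P.comap φ := by
    have h := D.base.root_mem_span_int ⟨α, hmem⟩
    generalize (rootSystem D.𝔱).root ⟨α, hmem⟩ = f at h
    induction h using Submodule.span_induction with
    | mem y hy =>
      obtain ⟨i, hi, rfl⟩ := hy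
      obtain ⟨k, hk⟩ := D.simple_int ⟨i, hi⟩
      exact ⟨k, hk.symm⟩
    | zero => exact zero_mem _
    | add y z _ _ hy hz => exact add_mem hy hz
    | smul n y _ hy => exact zsmul_mem hy n
  obtain ⟨k, hk⟩ := key
  exact ⟨k, hk.symm⟩

/-- `ad(m x)` is diagonalizable with integer eigenvalues, i.e. `m x` is a cocharacter of the
adjoint group: `𝔤 = ⨁ k, 𝔤(k)`. -/
theorem iSup_gr : ⨆ k, gr D.lam k = ⊤ := by
  have h := LieModule.iSup_genWeightSpace_eq_top' ℂ D.𝔱 𝔤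
  rw [← LieSubmodule.toSubmodule_inj, LieSubmodule.iSup_toSubmodule,
    LieSubmodule.top_toSubmodule] at h
  rw [eq_top_iff, ← h]
  refine iSup_le fun α => ?_
  obtain ⟨k, hk⟩ := D.weight_int α
  refine le_iSup_of_le k fun v hv => ?_
  rw [mem_gr, lam, smul_lie, D.lie_x_of_mem hv, smul_smul, hk]

theorem σ_gr {k : ℤ} {v : 𝔤} (hv : v ∈ gr D.lam k) : D.σ v ∈ gr D.lam k := by
  have hx : D.σ D.lam = D.lam := by rw [lam, map_smul, D.σ_x]
  rw [mem_gr] at *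
  conv_lhs => rw [← hx]
  rw [← LieEquiv.map_lie, hv, map_smul]

theorem θ_gr {k : ℤ} {v : 𝔤} (hv : v ∈ gr D.lam k) : D.θ v = ξ D.m ^ k • D.σ v := by
  have key : D.θEnd ∘ₗ D.σ.symm.toLinearEquiv.toLinearMap =
      glue D.iSup_gr fun k => ξ D.m ^ k • (gr D.lam k).subtype := by
    have h := LieModule.iSup_genWeightSpace_eq_top' ℂ D.𝔱 𝔤
    rw [← LieSubmodule.toSubmodule_inj, LieSubmodule.iSup_toSubmodule,
      LieSubmodule.top_toSubmodule] at h
    refine LinearMap.ext fun w => ?_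
    refine Submodule.iSup_induction _ (motive := fun w =>
      (D.θEnd ∘ₗ D.σ.symm.toLinearEquiv.toLinearMap) w =
        (glue D.iSup_gr fun k => ξ D.m ^ k • (gr D.lam k).subtype) w)
      (h ▸ Submodule.mem_top : w ∈ _) ?_ ?_ ?_
    · intro α w hw
      obtain ⟨l, hl⟩ := D.weight_int α
      have hw' : w ∈ gr D.lam l := by
        rw [mem_gr, lam, smul_lie, D.lie_x_of_mem hw, smul_smul, hl]
      rw [glue_apply _ _ hw']
      refine (D.θ_eq α w hw).trans ?_
      rw [LinearMap.smul_apply, Submodule.subtype_apply, ξ_zpow]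
      congr 2
      rw [← hl]
      have := D.m_ne_zero
      field_simp
    · rw [map_zero, map_zero]
    · intro w₁ w₂ h₁ h₂
      rw [map_add, map_add, h₁, h₂]
  have h := LinearMap.congr_fun key (D.σ v)
  rw [glue_apply _ _ (D.σ_gr hv)] at h
  have h2 : (D.θEnd ∘ₗ D.σ.symm.toLinearEquiv.toLinearMap) (D.σ v) = D.θ v :=
    congrArg D.θ (D.σ.symm_apply_apply v)
  rw [← h2, h]
  rfl

theorem σ_pow_m : D.σEnd ^ D.m = 1 := by
  refine LinearMap.ext fun w => ?_
  refine Submodule.iSup_induction (gr D.lam) (motive := fun w => (D.σEnd ^ D.m) w = w)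
    (D.iSup_gr ▸ Submodule.mem_top : w ∈ _) ?_ ?_ ?_
  · intro k v hv
    have h : ∀ n : ℕ, (D.σEnd ^ n) v ∈ gr D.lam k ∧
        (D.θEnd ^ n) v = (ξ D.m ^ k) ^ n • (D.σEnd ^ n) v := by
      intro n
      induction n with
      | zero => exact ⟨by simpa using hv, by simp⟩
      | succ n ih =>
        rw [pow_succ' D.σEnd, pow_succ' D.θEnd, Module.End.mul_apply, Module.End.mul_apply, ih.2]
        refine ⟨D.σ_gr ih.1, ?_⟩
        rw [map_smul, pow_succ, mul_smul]
        exact congrArg _ (D.θ_gr ih.1)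
    have h1 := (h D.m).2
    rw [show D.θEnd ^ D.m = 1 from pow_orderOf_eq_one _, Module.End.one_apply, ξ_zpow,
      ← Complex.exp_nat_mul] at h1
    have h2 : Complex.exp (D.m * (k * (2 * Real.pi * Complex.I / D.m))) = 1 := by
      rw [Complex.exp_eq_one_iff]
      refine ⟨k, ?_⟩
      have := D.m_ne_zero
      field_simp
    rw [h2, one_smul] at h1
    exact h1.symm
  · rw [map_zero]
  · intro w₁ w₂ h₁ h₂
    rw [map_add, h₁, h₂]

theorem e_dvd_m : D.e ∣ D.m := orderOf_dvd_of_pow_eq_one D.σ_pow_m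

theorem e_pos : 0 < D.e := Nat.pos_of_dvd_of_pos D.e_dvd_m D.m_pos

/-- `𝔤ᵢ`: the `ξₘⁱ`-eigenspace of `θ`; it depends only on `i` modulo `m`. -/
def θPiece (i : ℤ) : Submodule ℂ 𝔤 := Module.End.eigenspace D.θEnd (ξ D.m ^ i)

/-- The `ξₑⁱ`-eigenspace of `σ`. -/
def σPiece (i : ℤ) : Submodule ℂ 𝔤 := Module.End.eigenspace D.σEnd (ξ D.e ^ i)

theorem mem_θPiece {i : ℤ} {v : 𝔤} : v ∈ D.θPiece i ↔ D.θ v = ξ D.m ^ i • v :=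
  Module.End.mem_eigenspace_iff

theorem mem_σPiece {i : ℤ} {v : 𝔤} : v ∈ D.σPiece i ↔ D.σ v = ξ D.e ^ i • v :=
  Module.End.mem_eigenspace_iff

theorem lie_mem_θPiece (i j : ℤ) (v : 𝔤) (hv : v ∈ D.θPiece i) (w : 𝔤) (hw : w ∈ D.θPiece j) :
    ⁅v, w⁆ ∈ D.θPiece (i + j) := by
  rw [mem_θPiece] at *
  rw [LieEquiv.map_lie, hv, hw, smul_lie, lie_smul, smul_smul, zpow_add₀ (ξ_ne_zero _)]

theorem lie_mem_σPiece (i j : ℤ) (v : 𝔤) (hv : v ∈ D.σPiece i) (w : 𝔤) (hw : w ∈ D.σPiece j) :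
    ⁅v, w⁆ ∈ D.σPiece (i + j) := by
  rw [mem_σPiece] at *
  rw [LieEquiv.map_lie, hv, hw, smul_lie, lie_smul, smul_smul, zpow_add₀ (ξ_ne_zero _)]

/-- `𝔤(θ, m) = ⨁ i, uⁱ 𝔤ᵢ ⊆ 𝔤[u, u⁻¹]`. -/
def thetaLoop : LieSubalgebra ℂ (Loop 𝔤) := loopSub D.θPiece D.lie_mem_θPiece

/-- The twisted loop algebra: the fixed points in `𝔤[t, t⁻¹]` of the automorphism
`tⁱ ⊗ v ↦ ξₑ⁻ⁱ tⁱ ⊗ σ v`. -/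
def twistedLoop : LieSubalgebra ℂ (Loop 𝔤) := loopSub D.σPiece D.lie_mem_σPiece

/-- The integer `m / e`; thus `t = u ^ (m / e)`. -/
def N : ℕ := D.m / D.e

theorem e_mul_N : D.e * D.N = D.m := Nat.mul_div_cancel' D.e_dvd_m

theorem ξ_m_pow_N : ξ D.m ^ (D.N : ℤ) = ξ D.e := by
  rw [ξ_zpow, ξ]
  congr 1
  have h1 := D.m_ne_zero
  have h2 : (D.e : ℂ) ≠ 0 := Nat.cast_ne_zero.2 D.e_pos.ne'
  have h3 : (D.e : ℂ) * D.N = D.m := by exact_mod_cast D.e_mul_N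
  rw [← h3] at h1 ⊢
  have h4 : (D.N : ℂ) ≠ 0 := right_ne_zero_of_mul h1
  push_cast
  field_simp

/-- `𝔤[t, t⁻¹] → 𝔤[u, u⁻¹]`, `t ↦ u ^ (m / e)`. -/
def tToU : Loop 𝔤 →ₗ⁅ℂ⁆ Loop 𝔤 := subst (D.N : ℤ)

theorem tToU_injective : Function.Injective D.tToU :=
  subst_injective (Int.natCast_ne_zero.2 fun h => D.m_pos.ne' (by rw [← D.e_mul_N, h, mul_zero]))

/-- `Ad(λ(u⁻¹))` on `𝔤[u, u⁻¹]`, `λ = m x`. -/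
def adLam : Loop 𝔤 →ₗ⁅ℂ⁆ Loop 𝔤 := adCochar D.iSup_gr (-1)

theorem adLam_injective : Function.Injective D.adLam := adCochar_injective D.iSup_gr (-1)

theorem ξ_e_zpow (l : ℤ) : ξ D.e ^ l = ξ D.m ^ ((D.N : ℤ) * l) := by
  rw [zpow_mul, ξ_m_pow_N]

theorem lam_fixed {k : ℤ} {v : 𝔤} (hv : v ∈ gr D.lam k) : D.θ v ∈ gr D.lam k := by
  rw [D.θ_gr hv]
  exact Submodule.smul_mem _ _ (D.σ_gr hv)

theorem exists_N_mul {i k : ℤ} {v : 𝔤} (hv : v ≠ 0) (hσ : D.σ v = ξ D.m ^ (i - k) • v) :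
    ∃ l, i - k = D.N * l := by
  have h : ∀ n : ℕ, (D.σEnd ^ n) v = (ξ D.m ^ (i - k)) ^ n • v := by
    intro n
    induction n with
    | zero => simp
    | succ n ih =>
      rw [pow_succ' D.σEnd, Module.End.mul_apply, ih, map_smul, pow_succ, mul_smul]
      exact congrArg _ hσ
  have h1 := h D.e
  rw [show D.σEnd ^ D.e = 1 from pow_orderOf_eq_one _, Module.End.one_apply, ξ_zpow,
    ← Complex.exp_nat_mul] at h1
  have h2 := smul_left_injective ℂ hv ((one_smul ℂ v).trans h1)
  obtain ⟨l, hl⟩ := Complex.exp_eq_one_iff.1 h2.symm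
  refine ⟨l, ?_⟩
  have hm := D.m_ne_zero
  have he : (D.e : ℂ) ≠ 0 := Nat.cast_ne_zero.2 D.e_pos.ne'
  have h3 : (D.e : ℂ) * D.N = D.m := by exact_mod_cast D.e_mul_N
  have h4 : (2 * Real.pi * Complex.I : ℂ) ≠ 0 := Complex.two_pi_I_ne_zero
  have h5 : ((i - k : ℤ) : ℂ) = D.N * l := by
    refine mul_left_cancel₀ he (mul_left_cancel₀ h4 ?_)
    field_simp at hl
    rw [← mul_assoc (D.e : ℂ), h3, hl]
  exact_mod_cast h5

theorem map_eq : D.thetaLoop.map D.adLam = D.twistedLoop.map D.tToU := by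
  have hmono : ∀ {V : ℤ → Submodule ℂ 𝔤} {hV} (S : LieSubalgebra ℂ (Loop 𝔤))
      (p : Loop 𝔤 →ₗ⁅ℂ⁆ Loop 𝔤), (∀ i, V i ≤ ⨆ k, V i ⊓ gr D.lam k) →
      (∀ i k, ∀ v ∈ V i, v ∈ gr D.lam k → p (mono i v) ∈ S) → (loopSub V hV).map p ≤ S := by
    rintro V hV S p h1 h2 _ ⟨f, hf, rfl⟩
    have hf : ∀ i, coeff i f ∈ V i := hf
    change p f ∈ S
    rw [eq_sum_mono f, map_sum]
    refine sum_mem fun i _ => ?_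
    have h3 : (⨆ k, V i ⊓ gr D.lam k) ≤
        S.toSubmodule.comap ((p : Loop 𝔤 →ₗ[ℂ] Loop 𝔤) ∘ₗ mono i) :=
      iSup_le fun k v hv => h2 i k v hv.1 hv.2
    exact h3 (h1 i (hf i))
  refine le_antisymm (hmono _ _ ?_ ?_) (hmono _ _ ?_ ?_)
  · intro i
    exact eigenspace_le_iSup D.iSup_gr D.θEnd _ fun k v hv => D.lam_fixed hv
  · intro i k v hv hk
    rcases eq_or_ne v 0 with rfl | hv0
    · rw [map_zero, map_zero]; exact zero_mem _
    have hσ : D.σ v = ξ D.m ^ (i - k) • v := by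
      have h := D.θ_gr hk
      rw [D.mem_θPiece.1 hv] at h
      rw [sub_eq_neg_add, zpow_add₀ (ξ_ne_zero _), mul_smul, h, smul_smul, ← zpow_add₀ (ξ_ne_zero _)]
      simp
    obtain ⟨l, hl⟩ := D.exists_N_mul hv0 hσ
    refine ⟨mono l v, mono_mem_loopSub (D.mem_σPiece.2 ?_), ?_⟩
    · rw [hσ, ξ_e_zpow, hl]
    · change subst (D.N : ℤ) (mono l v) = adCochar D.iSup_gr (-1) (mono i v)
      rw [subst_mono, adCochar_mono _ _ _ hk, ← hl]
      congr 1
      ring_nf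
  · intro i
    exact eigenspace_le_iSup D.iSup_gr D.σEnd _ fun k v hv => D.σ_gr hv
  · intro l k v hv hk
    refine ⟨mono (D.N * l + k) v, mono_mem_loopSub (D.mem_θPiece.2 ?_), ?_⟩
    · rw [D.θ_gr hk, D.mem_σPiece.1 hv, ξ_e_zpow, smul_smul, ← zpow_add₀ (ξ_ne_zero _), add_comm]
    · change adCochar D.iSup_gr (-1) (mono _ v) = subst (D.N : ℤ) (mono l v)
      rw [subst_mono, adCochar_mono _ _ _ hk]
      congr 1
      ring_nf

/-- The isomorphism `Φ : 𝔤(θ, m) ≃ 𝔤[t, t⁻¹]^σ` induced by `Ad(λ(u⁻¹))`, where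
`𝔤[t, t⁻¹] ⊆ 𝔤[u, u⁻¹]` via `t = u ^ (m / e)`. -/
def Φ : D.thetaLoop ≃ₗ⁅ℂ⁆ D.twistedLoop :=
  (LieEquiv.ofInjective (D.adLam.comp D.thetaLoop.incl)
      (D.adLam_injective.comp Subtype.val_injective)).trans
    ((LieEquiv.ofEq _ _ (by
      have h := congrArg (fun S : LieSubalgebra ℂ (Loop 𝔤) => (S : Set (Loop 𝔤))) D.map_eq
      ext f
      have h' := Set.ext_iff.1 h f
      constructor
      · rintro ⟨g, rfl⟩
        obtain ⟨a, ha, hg⟩ := h'.1 ⟨g, g.2, rfl⟩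
        exact ⟨⟨a, ha⟩, hg⟩
      · rintro ⟨g, rfl⟩
        obtain ⟨a, ha, hg⟩ := h'.2 ⟨g, g.2, rfl⟩
        exact ⟨⟨a, ha⟩, hg⟩)).trans
      (LieEquiv.ofInjective (D.tToU.comp D.twistedLoop.incl)
        (D.tToU_injective.comp Subtype.val_injective)).symm)

theorem tToU_Φ (w : D.thetaLoop) : D.tToU (D.Φ w) = D.adLam w := by
  let ψ := LieEquiv.ofInjective (D.tToU.comp D.twistedLoop.incl)
        (D.tToU_injective.comp Subtype.val_injective)
  have h : ∀ z, D.tToU (ψ.symm z) = (z : Loop 𝔤) := fun z =>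
    congrArg Subtype.val (ψ.apply_symm_apply z)
  exact h _

/-- The element `uX` of `𝔤(θ, m)`, for `X ∈ 𝔤₁`. -/
def uX {X : 𝔤} (hX : X ∈ D.θPiece 1) : D.thetaLoop := ⟨mono 1 X, mono_mem_loopSub hX⟩

/-- The element `p₁ = Φ(uX)` of the twisted loop algebra. -/
def p₁ {X : 𝔤} (hX : X ∈ D.θPiece 1) : D.twistedLoop := D.Φ (D.uX hX)

/-- The invariant form on the twisted loop algebra, induced by `δ_{i,-j} κ(x, y)`. -/
def form : LinearMap.BilinForm ℂ D.twistedLoop :=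
  loopForm.compl₁₂ D.twistedLoop.toSubmodule.subtype D.twistedLoop.toSubmodule.subtype

/-- `𝔱^σ`. -/
def 𝔱σ : Submodule ℂ 𝔤 := D.𝔱.toSubmodule ⊓ Module.End.eigenspace D.σEnd 1

/-- The point `x` as an element of `𝔱^σ`. -/
def xσ : D.𝔱σ :=
  ⟨D.x, D.x.2, Module.End.mem_eigenspace_iff.2 (D.σ_x.trans (one_smul ℂ _).symm)⟩

/-- The affine weight space of weight `β + n δ`: the elements of the twisted loop algebra on which
`h ∈ 𝔱^σ` acts by `β h` and the derivation `t ∂ₜ` acts by `n`. It is nonzero only if `β + n δ` is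
an affine root or zero. -/
def affineWeightSpace (β : Module.Dual ℂ D.𝔱σ) (n : ℤ) : Submodule ℂ D.twistedLoop where
  carrier := {f | (∀ (h : D.𝔱σ) (i : ℤ),
      ⁅(h : 𝔤), coeff i (f : Loop 𝔤)⁆ = β h • coeff i (f : Loop 𝔤)) ∧
    ∀ i : ℤ, i • coeff i (f : Loop 𝔤) = n • coeff i (f : Loop 𝔤)}
  add_mem' {f g} hf hg := by
    refine ⟨fun h i => ?_, fun i => ?_⟩
    · change ⁅(h : 𝔤), coeff i ((f : Loop 𝔤) + (g : Loop 𝔤))⁆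
        = β h • coeff i ((f : Loop 𝔤) + (g : Loop 𝔤))
      rw [map_add, lie_add, smul_add, hf.1, hg.1]
    · change i • coeff i ((f : Loop 𝔤) + (g : Loop 𝔤)) = n • coeff i ((f : Loop 𝔤) + (g : Loop 𝔤))
      rw [map_add, smul_add, smul_add, hf.2, hg.2]
  zero_mem' := by
    refine ⟨fun h i => ?_, fun i => ?_⟩
    · change ⁅(h : 𝔤), coeff i (0 : Loop 𝔤)⁆ = β h • coeff i (0 : Loop 𝔤)
      rw [map_zero, lie_zero, smul_zero]
    · change i • coeff i (0 : Loop 𝔤) = n • coeff i (0 : Loop 𝔤)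
      rw [map_zero, smul_zero, smul_zero]
  smul_mem' c f hf := by
    refine ⟨fun h i => ?_, fun i => ?_⟩
    · change ⁅(h : 𝔤), coeff i (c • (f : Loop 𝔤))⁆ = β h • coeff i (c • (f : Loop 𝔤))
      rw [map_smul, lie_smul, hf.1, smul_comm]
    · change i • coeff i (c • (f : Loop 𝔤)) = n • coeff i (c • (f : Loop 𝔤))
      rw [map_smul, smul_comm, hf.2, smul_comm]

/-- The degree `i` piece of the Kac-Moy-Prasad grading attached to `x`: the sum of the affine
weight spaces of the `α = β + n δ` with `α(x) = i / m`, where affine weights are viewed as affine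
functions on `𝔱^σ` by sending `δ` to the constant `1 / e`. -/
def kmp (i : ℤ) : Submodule ℂ D.twistedLoop :=
  ⨆ (β : Module.Dual ℂ D.𝔱σ) (n : ℤ) (_ : β D.xσ + n / D.e = i / D.m), D.affineWeightSpace β n

end TorsionAut

/-- `Ker (ad p)` as a Lie subalgebra. -/
def kerAd {L : Type*} [LieRing L] [LieAlgebra ℂ L] (p : L) : LieSubalgebra ℂ L where
  toSubmodule := LinearMap.ker (LieAlgebra.ad ℂ L p)
  lie_mem' {a b} ha hb := by
    have ha' : ⁅p, a⁆ = 0 := ha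
    have hb' : ⁅p, b⁆ = 0 := hb
    change ⁅p, ⁅a, b⁆⁆ = 0
    rw [leibniz_lie, ha', hb', zero_lie, lie_zero, add_zero]

/-- `Im (ad p)`. -/
def imAd {L : Type*} [LieRing L] [LieAlgebra ℂ L] (p : L) : Submodule ℂ L :=
  LinearMap.range (LieAlgebra.ad ℂ L p)

/-- `X` is regular semisimple: `ad X` is semisimple and the centralizer of `X` is a Cartan
subalgebra. -/
def IsRegularSemisimple {𝔤 : Type*} [LieRing 𝔤] [LieAlgebra ℂ 𝔤] (X : 𝔤) : Prop :=
  (LieAlgebra.ad ℂ 𝔤 X).IsSemisimple ∧ (kerAd X).IsCartanSubalgebra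

/-- The restriction `f⁻¹(S) → S` of a Lie algebra homomorphism `f`. -/
def preimageHom {L M : Type*} [LieRing L] [LieAlgebra ℂ L] [LieRing M] [LieAlgebra ℂ M]
    (f : L →ₗ⁅ℂ⁆ M) (S : LieSubalgebra ℂ M) : S.comap f →ₗ⁅ℂ⁆ S where
  toFun z := ⟨f z, z.2⟩
  map_add' a b := Subtype.ext (map_add f (a : L) (b : L))
  map_smul' c a := Subtype.ext (map_smul f c (a : L))
  map_lie' {a b} := Subtype.ext (LieHom.map_lie f (a : L) (b : L))

section KacMoody

variable (𝔤 : Type*) [LieRing 𝔤] [LieAlgebra ℂ 𝔤]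

/-- The 2-cocycle `(tⁱ ⊗ x, tʲ ⊗ y) ↦ i δ_{i,-j} κ(x, y)` of the loop algebra. -/
def kmCocycle : LieModule.Cohomology.twoCocycle ℂ (Loop 𝔤) (TrivialLieModule ℂ (Loop 𝔤) ℂ) :=
  LieAlgebra.LoopAlgebra.twoCocycleOfBilinear ℂ ℤ 𝔤 (-killingForm ℂ 𝔤)
    (fun x y z => by
      rw [LinearMap.neg_apply, LinearMap.neg_apply, LinearMap.neg_apply, LinearMap.neg_apply,
        LieModule.traceForm_lieInvariant ℂ 𝔤 𝔤 x y z])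
    ⟨fun x y => by
      rw [LinearMap.neg_apply, LinearMap.neg_apply, LinearMap.neg_apply, LinearMap.neg_apply,
        show killingForm ℂ 𝔤 x y = killingForm ℂ 𝔤 y x from LieModule.traceForm_comm ℂ 𝔤 𝔤 x y]⟩

/-- The Kac-Moody central extension `𝔤[t, t⁻¹] ⊕ ℂ K` of the loop algebra. -/
abbrev KMExt : Type _ := LieAlgebra.ofTwoCocycle (kmCocycle 𝔤)

variable {𝔤}

/-- The element `f + c K`. -/
def KMExt.mk (f : Loop 𝔤) (c : ℂ) : KMExt 𝔤 :=
  LieAlgebra.ofProd _ (f, (TrivialLieModule.equiv ℂ (Loop 𝔤) ℂ).symm c)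

variable (𝔤) in
/-- The central element `K`. -/
def KMExt.K : KMExt 𝔤 := KMExt.mk 0 1

variable (𝔤) in
/-- The projection `f + c K ↦ f`. -/
def KMExt.proj : KMExt 𝔤 →ₗ⁅ℂ⁆ Loop 𝔤 where
  toFun z := ((LieAlgebra.ofProd _).symm z).1
  map_add' _ _ := rfl
  map_smul' _ _ := rfl
  map_lie' {_ _} := rfl

theorem KMExt.lie_mk_mono (i j : ℤ) (v w : 𝔤) (a b : ℂ) :
    ⁅KMExt.mk (mono i v) a, KMExt.mk (mono j w) b⁆ =
      KMExt.mk (mono (i + j) ⁅v, w⁆) (if i + j = 0 then i * killingForm ℂ 𝔤 v w else 0) := by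
  have h : LieAlgebra.LoopAlgebra.residuePairing ℂ ℤ 𝔤 (-killingForm ℂ 𝔤) (mono i v) (mono j w) =
      if i + j = 0 then i * killingForm ℂ 𝔤 v w else 0 := by
    have h1 : LieAlgebra.LoopAlgebra.residuePairing ℂ ℤ 𝔤 (-killingForm ℂ 𝔤) (mono i v) (mono j w)
        = j • (-killingForm ℂ 𝔤) (coeff (-j) (mono i v)) w := by
      simp only [LieAlgebra.LoopAlgebra.residuePairing_apply_apply, mono, TensorProduct.mk_apply,
        LieAlgebra.LoopAlgebra.toFinsupp_single_tmul, coeff, LinearMap.comp_apply,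
        LinearEquiv.coe_coe, Finsupp.lapply_apply]
      rw [Finsupp.sum_single_index (by simp)]
    rw [h1, coeff_mono]
    by_cases h2 : i + j = 0
    · rw [if_pos h2, if_pos (by omega), show j = -i by omega]
      simp
    · rw [if_neg h2, if_neg (by omega), map_zero, LinearMap.zero_apply, smul_zero]
  rw [← h]
  have h3 : ∀ f g : Loop 𝔤, ⁅KMExt.mk f a, KMExt.mk g b⁆ = KMExt.mk ⁅f, g⁆
      (LieAlgebra.LoopAlgebra.residuePairing ℂ ℤ 𝔤 (-killingForm ℂ 𝔤) f g) := by
    intro f g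
    change LieAlgebra.ofProd (kmCocycle 𝔤) (⁅f, g⁆, (TrivialLieModule.equiv ℂ (Loop 𝔤) ℂ).symm
        (LieAlgebra.LoopAlgebra.residuePairing ℂ ℤ 𝔤 (-killingForm ℂ 𝔤) f g) +
        ⁅f, (TrivialLieModule.equiv ℂ (Loop 𝔤) ℂ).symm b⁆ -
        ⁅g, (TrivialLieModule.equiv ℂ (Loop 𝔤) ℂ).symm a⁆) = _
    rw [trivial_lie_zero (Loop 𝔤) (TrivialLieModule ℂ (Loop 𝔤) ℂ),
      trivial_lie_zero (Loop 𝔤) (TrivialLieModule ℂ (Loop 𝔤) ℂ), add_zero, sub_zero]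
    rfl
  rw [h3, lie_mono]

end KacMoody

namespace TorsionAut

variable {𝔤 : Type*} [LieRing 𝔤] [LieAlgebra ℂ 𝔤] [FiniteDimensional ℂ 𝔤]
  [LieAlgebra.IsSimple ℂ 𝔤] (D : TorsionAut 𝔤)

/-- The Kac-Moody central extension of the twisted loop algebra, i.e. the sum of the twisted
loop algebra and `ℂ K` inside `𝔤[t, t⁻¹] ⊕ ℂ K`. -/
def twistedKM : LieSubalgebra ℂ (KMExt 𝔤) := D.twistedLoop.comap (KMExt.proj 𝔤)

/-- Its projection to the twisted loop algebra. -/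
def twistedProj : D.twistedKM →ₗ⁅ℂ⁆ D.twistedLoop := preimageHom (KMExt.proj 𝔤) D.twistedLoop

/-- The central element `K`. -/
def K : D.twistedKM := ⟨KMExt.K 𝔤, D.twistedLoop.zero_mem⟩

variable {X : 𝔤} (hX : X ∈ D.θPiece 1)

/-- `𝔞 = Ker (ad p₁)`. -/
def 𝔞 : LieSubalgebra ℂ D.twistedLoop := kerAd (D.p₁ hX)

/-- `𝔠 = Im (ad p₁)`. -/
def 𝔠 : Submodule ℂ D.twistedLoop := imAd (D.p₁ hX)

/-- `𝔞ᵢ`: the degree `i` piece of `𝔞` for the Kac-Moy-Prasad grading. -/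
def 𝔞Piece (i : ℤ) : Submodule ℂ (D.𝔞 hX) := (D.kmp i).comap (D.𝔞 hX).toSubmodule.subtype

/-- The pre-image of `𝔞` in the Kac-Moody central extension of the twisted loop algebra. -/
def 𝔞Hat : LieSubalgebra ℂ D.twistedKM := (D.𝔞 hX).comap D.twistedProj

/-- The projection of the pre-image of `𝔞` onto `𝔞`. -/
def 𝔞Proj : D.𝔞Hat hX →ₗ⁅ℂ⁆ D.𝔞 hX := preimageHom D.twistedProj (D.𝔞 hX)

end TorsionAut

end KacLoop

end

/-! Everything is computed on the `u`-side of `Φ`. There `p₁` becomes `uX`, whose adjoint action `uⁱ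
⊗ v ↦ uⁱ⁺¹ ⊗ [X, v]` works coefficient by coefficient, so statements about `𝔞` and `𝔠` reduce to
statements about `ad X` on the pieces `𝔤ᵢ`. Since `ad X` is semisimple, `𝔤 = Ker (ad X) ⊕ Im (ad
X)`, and this splitting is compatible with the grading by `θ` (`exists_ker_add_lie`). That gives the
decomposition in part 1; orthogonality is invariance of the form. Commutativity of `𝔞` holds because
the coefficients of its elements lie in the centralizer of `X`, a Cartan subalgebra.

Three structures have to be carried through `Φ`. The form is preserved, because the Killing form
pairs `𝔤(k)` only with `𝔤(-k)` (`form_Φ`). The Kac–Moy–Prasad degree becomes the degree in `u`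
(`kmp_eq`). The Kac–Moody cocycle `ω` is preserved up to the factor `m / e` and a correction by the
coboundary term `⟨[λ, f], g⟩` (`loopCocycle_Φ`).

Nondegeneracy of the pairing of `𝔞ᵢ` with `𝔞₋ᵢ` follows from that of the Killing form: an element of
`𝔤ᵢ` that centralizes `X` is already orthogonal to `Im (ad X)`, so if it also kills `Ker (ad X) ∩
𝔤₋ᵢ` it is zero.

For part 3, the correction term vanishes between `p₁` and `𝔞₋₁`, so there `ω(p₁, ·)` is `⟨p₁, ·⟩`
divided by `m / e`. As `p₁` is a nonzero element of `𝔞₁`, nondegeneracy yields `b` with `ω(p₁, b) ≠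
0`. Lifts of `p₁` and `b` then never commute, whereas a section would embed the commutative `𝔞` and
give commuting lifts. -/

noncomputable section

open scoped TensorProduct
open LieAlgebra LieAlgebra.IsKilling

namespace KacLoop

/-! ### Linear algebra: averaging over a cyclic group, and semisimple endomorphisms -/

section LinearAlgebra

variable {V : Type*} [AddCommGroup V] [Module ℂ V]

/-- The average `(1 / m) ∑ j, z⁻ʲ Aʲ`; if `A ^ m = 1` and `z ^ m = 1`, it is the projection onto
the eigenspace of `A` for the eigenvalue `z`. -/
def eigenAverage (A : Module.End ℂ V) (m : ℕ) (z : ℂ) : Module.End ℂ V :=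
  (m : ℂ)⁻¹ • ∑ j ∈ Finset.range m, z⁻¹ ^ j • A ^ j

theorem eigenAverage_apply (A : Module.End ℂ V) (m : ℕ) (z : ℂ) (v : V) :
    eigenAverage A m z v = (m : ℂ)⁻¹ • ∑ j ∈ Finset.range m, z⁻¹ ^ j • (A ^ j) v := by
  simp [eigenAverage, LinearMap.sum_apply]

/-- Applying `A` shifts the summation index by one, and the term `j = m` equals the term `j = 0`
because `A ^ m = 1` and `z ^ m = 1`. -/
theorem map_eigenAverage {A : Module.End ℂ V} {m : ℕ} {z : ℂ} (hA : A ^ m = 1) (hz : z ^ m = 1)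
    (hz0 : z ≠ 0) (v : V) : A (eigenAverage A m z v) = z • eigenAverage A m z v := by
  have h1 := Finset.sum_range_succ' (fun j => z⁻¹ ^ j • (A ^ j) v) m
  rw [Finset.sum_range_succ, hA, inv_pow, hz] at h1
  have h2 : ∑ j ∈ Finset.range m, z⁻¹ ^ (j + 1) • (A ^ (j + 1)) v
      = ∑ j ∈ Finset.range m, z⁻¹ ^ j • (A ^ j) v := by
    simpa using h1.symm
  rw [eigenAverage_apply, map_smul, smul_comm]
  congr 1
  conv_rhs => rw [← h2]
  rw [map_sum, Finset.smul_sum]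
  refine Finset.sum_congr rfl fun j _ => ?_
  rw [map_smul, smul_smul, pow_succ', pow_succ' A, ← mul_assoc, mul_inv_cancel₀ hz0, one_mul]
  rfl

theorem pow_apply_of_eigen {A : Module.End ℂ V} {z : ℂ} {v : V} (hv : A v = z • v) (j : ℕ) :
    (A ^ j) v = z ^ j • v := by
  induction j with
  | zero => simp
  | succ j ih => rw [pow_succ', Module.End.mul_apply, ih, map_smul, hv, smul_smul, pow_succ]

theorem eigenAverage_of_eigen {A : Module.End ℂ V} {m : ℕ} {z : ℂ} (hm : m ≠ 0) (hz0 : z ≠ 0)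
    {v : V} (hv : A v = z • v) : eigenAverage A m z v = v := by
  rw [eigenAverage_apply]
  have : ∀ j ∈ Finset.range m, z⁻¹ ^ j • (A ^ j) v = v := fun j _ => by
    rw [pow_apply_of_eigen hv, smul_smul, inv_pow, inv_mul_cancel₀ (pow_ne_zero j hz0), one_smul]
  rw [Finset.sum_congr rfl this, Finset.sum_const, Finset.card_range, ← Nat.cast_smul_eq_nsmul ℂ,
    smul_smul, inv_mul_cancel₀ (Nat.cast_ne_zero.2 hm), one_smul]

theorem eigenAverage_mem {A : Module.End ℂ V} {W : Submodule ℂ V} (hW : ∀ v ∈ W, A v ∈ W) (m : ℕ)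
    (z : ℂ) {v : V} (hv : v ∈ W) : eigenAverage A m z v ∈ W := by
  have h : ∀ j : ℕ, (A ^ j) v ∈ W := fun j => by
    induction j with
    | zero => simpa using hv
    | succ j ih => rw [pow_succ', Module.End.mul_apply]; exact hW _ ih
  rw [eigenAverage_apply]
  exact W.smul_mem _ (W.sum_mem fun j _ => W.smul_mem _ (h j))

/-- All the vectors being averaged, `z⁻ʲ Aʲ v`, have the same value under `φ`. With `φ = κ(v, ·)`
this lets a Killing pairing be tested on one eigenspace of `θ` only. -/
theorem functional_eigenAverage {A : Module.End ℂ V} {m : ℕ} {z : ℂ} (hm : m ≠ 0) (hz0 : z ≠ 0)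
    (φ : V →ₗ[ℂ] ℂ) (hφ : ∀ v, φ (A v) = z * φ v) (v : V) :
    φ (eigenAverage A m z v) = φ v := by
  have h : ∀ j : ℕ, φ ((A ^ j) v) = z ^ j * φ v := fun j => by
    induction j with
    | zero => simp
    | succ j ih => rw [pow_succ', Module.End.mul_apply, hφ, ih, pow_succ', mul_assoc]
  rw [eigenAverage_apply, map_smul, map_sum]
  have : ∀ j ∈ Finset.range m, φ (z⁻¹ ^ j • (A ^ j) v) = φ v := fun j _ => by
    rw [map_smul, h, smul_eq_mul, inv_pow, inv_mul_cancel_left₀ (pow_ne_zero j hz0)]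
  rw [Finset.sum_congr rfl this, Finset.sum_const, Finset.card_range, nsmul_eq_mul, smul_eq_mul,
    inv_mul_cancel_left₀ (Nat.cast_ne_zero.2 hm)]

/-- The kernel and the range of a semisimple endomorphism are disjoint. -/
theorem disjoint_ker_range {A : Module.End ℂ V} (hA : A.IsSemisimple) {v : V}
    (hv : A (A v) = 0) : A v = 0 := by
  -- An `A`-invariant complement `q` of the kernel: `A v` depends only on the `q`-component of `v`,
  -- so it lies in both `q` and the kernel.
  obtain ⟨q, hq, hc⟩ := Module.End.isSemisimple_iff.1 hA (LinearMap.ker A)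
    (fun w hw => by
      change A (A w) = 0
      rw [LinearMap.mem_ker.1 hw, map_zero])
  have hvt : v ∈ LinearMap.ker A ⊔ q := hc.sup_eq_top ▸ Submodule.mem_top
  obtain ⟨a, ha, b, hb, rfl⟩ := Submodule.mem_sup.1 hvt
  rw [map_add, LinearMap.mem_ker.1 ha, zero_add] at hv ⊢
  exact (Submodule.disjoint_def.1 hc.disjoint) _ (LinearMap.mem_ker.2 hv) (hq hb)

/-- The splitting into kernel and range is applied twice, so that the preimage `A w` of the second
summand lies itself in the range. `A` is injective there, which makes this preimage unique and hence
compatible with any grading. -/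
theorem exists_ker_add_range [FiniteDimensional ℂ V] {A : Module.End ℂ V} (hA : A.IsSemisimple)
    (v : V) : ∃ h w, A h = 0 ∧ v = h + A (A w) := by
  have hd : Disjoint (LinearMap.ker A) (LinearMap.range A) := by
    rw [Submodule.disjoint_def]
    rintro _ h ⟨w, rfl⟩
    exact disjoint_ker_range hA h
  have hsum : ∀ v, ∃ h w, A h = 0 ∧ v = h + A w := fun v => by
    have ht : LinearMap.ker A ⊔ LinearMap.range A = ⊤ := by
      apply Submodule.eq_top_of_disjoint _ _ _ hd
      rw [add_comm]
      exact (LinearMap.finrank_range_add_finrank_ker A).ge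
    have hvt : v ∈ LinearMap.ker A ⊔ LinearMap.range A := ht ▸ Submodule.mem_top
    obtain ⟨h, hh, _, ⟨w, rfl⟩, rfl⟩ := Submodule.mem_sup.1 hvt
    exact ⟨h, w, hh, rfl⟩
  obtain ⟨h, w, hh, rfl⟩ := hsum v
  obtain ⟨h', w', hh', rfl⟩ := hsum w
  exact ⟨h, w', hh, by rw [map_add, hh', zero_add]⟩

/-- Subspaces `U i` on which all but the `i`-th of a jointly injective family of linear maps vanish
are independent. -/
theorem iSupIndep_of_forall_ne {ι M : Type*} [AddCommGroup M] [Module ℂ M] {U : ι → Submodule ℂ V}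
    (c : ι → V →ₗ[ℂ] M) (hc : ∀ v, (∀ i, c i v = 0) → v = 0)
    (hU : ∀ i, ∀ v ∈ U i, ∀ j, j ≠ i → c j v = 0) : iSupIndep U := by
  intro i
  rw [Submodule.disjoint_def]
  intro v hv hv'
  refine hc v fun j => ?_
  by_cases hj : j = i
  · subst hj
    have : (⨆ k, ⨆ (_ : k ≠ j), U k) ≤ LinearMap.ker (c j) :=
      iSup₂_le fun k hk w hw => hU k w hw j hk.symm
    exact this hv'
  · exact hU i v hv j hj

end LinearAlgebra

/-! ### Loop algebra: coefficients, the invariant form and its transformation -/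

section Loop

variable {𝔤 : Type*} [LieRing 𝔤] [LieAlgebra ℂ 𝔤]

theorem ad_mono_mono (i j : ℤ) (v w : 𝔤) :
    ad ℂ (Loop 𝔤) (mono i v) (mono j w) = mono (i + j) ⁅v, w⁆ :=
  lie_mono i j v w

@[elab_as_elim]
theorem mono_induction {P : Loop 𝔤 → Prop} (f : Loop 𝔤) (h0 : P 0)
    (hadd : ∀ f g, P f → P g → P (f + g)) (hm : ∀ (i : ℤ) (v : 𝔤), P (mono i v)) : P f :=
  loop_induction (W := fun _ : Unit => ⊤) (by simp) h0 hadd (fun i _ v _ => hm i v) f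

theorem coeff_ad_mono (i j : ℤ) (v : 𝔤) (f : Loop 𝔤) :
    coeff j (ad ℂ (Loop 𝔤) (mono i v) f) = ⁅v, coeff (j - i) f⁆ := by
  refine mono_induction f ?_ ?_ ?_
  · simp
  · intro f g hf hg
    rw [map_add, map_add, hf, hg, map_add, lie_add]
  · intro k w
    rw [ad_mono_mono, coeff_mono, coeff_mono]
    by_cases h : i + k = j
    · rw [if_pos h, if_pos (by omega)]
    · rw [if_neg h, if_neg (by omega), lie_zero]

theorem ad_mono_eq_zero_iff {i : ℤ} {v : 𝔤} {f : Loop 𝔤} :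
    ad ℂ (Loop 𝔤) (mono i v) f = 0 ↔ ∀ j, ⁅v, coeff j f⁆ = 0 := by
  refine ⟨fun h j => ?_, fun h => ext_coeff fun j => ?_⟩
  · have := coeff_ad_mono i (j + i) v f
    rw [h, map_zero, add_sub_cancel_right] at this
    exact this.symm
  · rw [coeff_ad_mono, h, map_zero]

theorem ad_eq_zero_of_coeff {f g : Loop 𝔤} (h : ∀ i j, ⁅coeff i f, coeff j g⁆ = 0) :
    ad ℂ (Loop 𝔤) f g = 0 := by
  rw [eq_sum_mono f, map_sum, LinearMap.sum_apply]
  exact Finset.sum_eq_zero fun i _ => ad_mono_eq_zero_iff.2 (h i)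

theorem eq_mono_of_coeff {i : ℤ} {f : Loop 𝔤} (h : ∀ j, j ≠ i → coeff j f = 0) :
    f = mono i (coeff i f) := by
  refine ext_coeff fun j => ?_
  rw [coeff_mono]
  split_ifs with hj
  · rw [hj]
  · exact h j (Ne.symm hj)

theorem loopForm_mono_right (f : Loop 𝔤) (j : ℤ) (w : 𝔤) :
    loopForm f (mono j w) = killingForm ℂ 𝔤 (coeff (-j) f) w := by
  refine mono_induction f ?_ ?_ ?_
  · simp
  · intro f g hf hg
    rw [map_add, LinearMap.add_apply, hf, hg, map_add, map_add, LinearMap.add_apply]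
  · intro k v
    rw [loopForm_mono, coeff_mono]
    by_cases h : k + j = 0
    · rw [if_pos h, if_pos (by omega)]
    · rw [if_neg h, if_neg (by omega), map_zero, LinearMap.zero_apply]

theorem killingForm_lie (x y z : 𝔤) :
    killingForm ℂ 𝔤 ⁅x, y⁆ z = -killingForm ℂ 𝔤 y ⁅x, z⁆ :=
  LieModule.traceForm_lieInvariant ℂ 𝔤 𝔤 x y z

theorem loopForm_ad (i : ℤ) (x : 𝔤) (f g : Loop 𝔤) :
    loopForm (ad ℂ (Loop 𝔤) (mono i x) f) g = -loopForm f (ad ℂ (Loop 𝔤) (mono i x) g) := by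
  refine mono_induction g ?_ ?_ ?_
  · simp
  · intro g h hg hh
    rw [map_add, map_add, map_add, hg, hh, neg_add]
  · intro j w
    rw [ad_mono_mono, loopForm_mono_right, loopForm_mono_right, coeff_ad_mono, killingForm_lie,
      neg_add', neg_sub_comm]

/-- Two linear forms that agree on monomials with coefficients in the `W k` are equal. -/
theorem bilin_ext_mono {ι : Type*} {W : ι → Submodule ℂ 𝔤} (hW : ⨆ k, W k = ⊤)
    {B C : LinearMap.BilinForm ℂ (Loop 𝔤)}
    (h : ∀ i j k l, ∀ v ∈ W k, ∀ w ∈ W l, B (mono i v) (mono j w) = C (mono i v) (mono j w)) :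
    B = C := by
  refine LinearMap.ext fun f => LinearMap.ext fun g => ?_
  refine loop_induction (P := fun f => B f g = C f g) hW (by simp) (fun f f' hf hf' => ?_)
    (fun i k v hv => ?_) f
  · rw [map_add, map_add, LinearMap.add_apply, LinearMap.add_apply, hf, hf']
  · refine loop_induction (P := fun g => B (mono i v) g = C (mono i v) g) hW (by simp)
      (fun g g' hg hg' => ?_) (fun j l w hw => ?_) g
    · rw [map_add, map_add, hg, hg']
    · exact h i j k l v hv w hw

theorem loopForm_subst {N : ℤ} (hN : N ≠ 0) (f g : Loop 𝔤) :
    loopForm (subst N f) (subst N g) = loopForm f g := by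
  have : loopForm.compl₁₂ (subst N : Loop 𝔤 →ₗ⁅ℂ⁆ Loop 𝔤).toLinearMap
      (subst N : Loop 𝔤 →ₗ⁅ℂ⁆ Loop 𝔤).toLinearMap = loopForm := by
    refine bilin_ext_mono (W := fun _ : Unit => ⊤) (by simp) fun i j _ _ v _ w _ => ?_
    change loopForm (subst N (mono i v)) (subst N (mono j w)) = _
    rw [subst_mono, subst_mono, loopForm_mono, loopForm_mono, ← mul_add]
    simp [hN]
  exact LinearMap.congr_fun₂ this f g

/-- Invariance under `ad H` gives `(k + l) κ(v, w) = 0`. -/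
theorem killingForm_gr {H : 𝔤} {k l : ℤ} {v w : 𝔤} (hv : v ∈ gr H k) (hw : w ∈ gr H l)
    (h : k + l ≠ 0) : killingForm ℂ 𝔤 v w = 0 := by
  have h1 := killingForm_lie H v w
  rw [mem_gr.1 hv, mem_gr.1 hw, map_smul, map_smul, LinearMap.smul_apply, smul_eq_mul,
    smul_eq_mul] at h1
  have h2 : ((k + l : ℤ) : ℂ) * killingForm ℂ 𝔤 v w = 0 := by
    push_cast
    linear_combination h1
  exact (mul_eq_zero.1 h2).resolve_left (Int.cast_ne_zero.2 h)

/-- On `𝔤(k)` and `𝔤(l)` the sum of the two exponents changes by `ε (k + l)`, and when this factor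
`k + l` is nonzero the Killing form vanishes anyway. -/
theorem loopForm_adCochar {H : 𝔤} (hH : ⨆ k, gr H k = ⊤) (ε : ℤ) (f g : Loop 𝔤) :
    loopForm (adCochar hH ε f) (adCochar hH ε g) = loopForm f g := by
  have : loopForm.compl₁₂ (adCochar hH ε).toLinearMap (adCochar hH ε).toLinearMap = loopForm := by
    refine bilin_ext_mono hH fun i j k l v hv w hw => ?_
    change loopForm (adCochar hH ε (mono i v)) (adCochar hH ε (mono j w)) = _
    rw [adCochar_mono hH ε _ hv, adCochar_mono hH ε _ hw, loopForm_mono, loopForm_mono]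
    by_cases h : k + l = 0
    · have : i + ε * k + (j + ε * l) = i + j := by linear_combination ε * h
      rw [this]
    · rw [killingForm_gr hv hw h, ite_self, ite_self]
  exact LinearMap.congr_fun₂ this f g

/-! ### The Kac–Moody cocycle and its transformation -/

/-- The bilinear form with `(tⁱ ⊗ x, tʲ ⊗ y) ↦ i δ_{i,-j} κ(x, y)`. -/
def loopCocycle : LinearMap.BilinForm ℂ (Loop 𝔤) :=
  LieAlgebra.LoopAlgebra.residuePairing ℂ ℤ 𝔤 (-killingForm ℂ 𝔤)

/-- The coefficients of `K` in the two arguments do not enter, so the bracket of two lifts depends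
only on the elements lifted. -/
theorem KMExt.lie_mk (f g : Loop 𝔤) (a b : ℂ) :
    ⁅KMExt.mk f a, KMExt.mk g b⁆ = KMExt.mk ⁅f, g⁆ (loopCocycle f g) := by
  change LieAlgebra.ofProd (kmCocycle 𝔤) (⁅f, g⁆, (TrivialLieModule.equiv ℂ (Loop 𝔤) ℂ).symm
      (LieAlgebra.LoopAlgebra.residuePairing ℂ ℤ 𝔤 (-killingForm ℂ 𝔤) f g) +
      ⁅f, (TrivialLieModule.equiv ℂ (Loop 𝔤) ℂ).symm b⁆ -
      ⁅g, (TrivialLieModule.equiv ℂ (Loop 𝔤) ℂ).symm a⁆) = _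
  rw [trivial_lie_zero (Loop 𝔤) (TrivialLieModule ℂ (Loop 𝔤) ℂ),
    trivial_lie_zero (Loop 𝔤) (TrivialLieModule ℂ (Loop 𝔤) ℂ), add_zero, sub_zero]
  rfl

theorem KMExt.mk_injective {f g : Loop 𝔤} {a b : ℂ} (h : KMExt.mk f a = KMExt.mk g b) :
    f = g ∧ a = b := by
  have h1 := (LieAlgebra.ofProd _).injective h
  exact ⟨congrArg Prod.fst h1, (TrivialLieModule.equiv ℂ (Loop 𝔤) ℂ).symm.injective
    (congrArg Prod.snd h1)⟩

theorem KMExt.eq_mk (z : KMExt 𝔤) : ∃ c, z = KMExt.mk (KMExt.proj 𝔤 z) c :=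
  ⟨TrivialLieModule.equiv ℂ (Loop 𝔤) ℂ ((LieAlgebra.ofProd _).symm z).2, rfl⟩

theorem KMExt.smul_K (c : ℂ) : c • KMExt.K 𝔤 = KMExt.mk 0 c := by
  have : c • KMExt.K 𝔤 = KMExt.mk (c • (0 : Loop 𝔤)) (c • (1 : ℂ)) := rfl
  rw [this, smul_zero, smul_eq_mul, mul_one]

theorem loopCocycle_mono (i j : ℤ) (v w : 𝔤) :
    loopCocycle (mono i v) (mono j w) = if i + j = 0 then i * killingForm ℂ 𝔤 v w else 0 :=
  (KMExt.mk_injective ((KMExt.lie_mk (mono i v) (mono j w) 0 0).symm.trans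
    (KMExt.lie_mk_mono i j v w 0 0))).2

theorem loopCocycle_subst {N : ℤ} (hN : N ≠ 0) (f g : Loop 𝔤) :
    loopCocycle (subst N f) (subst N g) = N * loopCocycle f g := by
  have : loopCocycle.compl₁₂ (subst N : Loop 𝔤 →ₗ⁅ℂ⁆ Loop 𝔤).toLinearMap
      (subst N : Loop 𝔤 →ₗ⁅ℂ⁆ Loop 𝔤).toLinearMap = (N : ℂ) • loopCocycle := by
    refine bilin_ext_mono (W := fun _ : Unit => ⊤) (by simp) fun i j _ _ v _ w _ => ?_
    change loopCocycle (subst N (mono i v)) (subst N (mono j w)) = N * loopCocycle _ _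
    rw [subst_mono, subst_mono, loopCocycle_mono, loopCocycle_mono, ← mul_add]
    simp [hN, mul_assoc]
  exact LinearMap.congr_fun₂ this f g

/-- For `v ∈ 𝔤(k)` the factor `i` of the cocycle becomes `i + ε k`, and `k κ(v, w) = κ([H, v], w)`.
By invariance the extra term is `ε ⟨H, [f, g]⟩`, a coboundary. -/
theorem loopCocycle_adCochar {H : 𝔤} (hH : ⨆ k, gr H k = ⊤) (ε : ℤ) (f g : Loop 𝔤) :
    loopCocycle (adCochar hH ε f) (adCochar hH ε g) =
      loopCocycle f g + ε * loopForm (ad ℂ (Loop 𝔤) (mono 0 H) f) g := by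
  have : loopCocycle.compl₁₂ (adCochar hH ε).toLinearMap (adCochar hH ε).toLinearMap =
      loopCocycle + (ε : ℂ) • loopForm ∘ₗ (LieAlgebra.ad ℂ (Loop 𝔤) (mono 0 H)) := by
    refine bilin_ext_mono hH fun i j k l v hv w hw => ?_
    change loopCocycle (adCochar hH ε (mono i v)) (adCochar hH ε (mono j w)) =
      loopCocycle _ _ + ε * loopForm (ad ℂ (Loop 𝔤) (mono 0 H) (mono i v)) (mono j w)
    rw [adCochar_mono hH ε _ hv, adCochar_mono hH ε _ hw, ad_mono_mono, mem_gr.1 hv, zero_add,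
      loopForm_mono, loopCocycle_mono, loopCocycle_mono, map_smul, LinearMap.smul_apply]
    by_cases h : k + l = 0
    · have : i + ε * k + (j + ε * l) = i + j := by linear_combination ε * h
      rw [this]
      split_ifs
      · push_cast
        rw [smul_eq_mul]
        ring
      · simp
    · simp [killingForm_gr hv hw h]
  exact LinearMap.congr_fun₂ this f g

end Loop

/-! ### Regular semisimple elements -/

/-- Cartan subalgebras are abelian when the Killing form is nondegenerate, and the centralizer of
`X` is one. -/
theorem IsRegularSemisimple.lie_eq_zero {𝔤 : Type*} [LieRing 𝔤] [LieAlgebra ℂ 𝔤]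
    [FiniteDimensional ℂ 𝔤] [LieAlgebra.IsKilling ℂ 𝔤] {X : 𝔤} (hX : IsRegularSemisimple X)
    {a b : 𝔤} (ha : ⁅X, a⁆ = 0) (hb : ⁅X, b⁆ = 0) : ⁅a, b⁆ = 0 := by
  have := hX.2
  have h := trivial_lie_zero (kerAd X) (kerAd X) ⟨a, ha⟩ ⟨b, hb⟩
  exact congrArg Subtype.val h

/-- The centralizer of `0` is all of `𝔤`, which is not abelian. -/
theorem IsRegularSemisimple.ne_zero {𝔤 : Type*} [LieRing 𝔤] [LieAlgebra ℂ 𝔤]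
    [FiniteDimensional ℂ 𝔤] [LieAlgebra.IsSimple ℂ 𝔤] {X : 𝔤} (hX : IsRegularSemisimple X) :
    X ≠ 0 := by
  rintro rfl
  exact LieAlgebra.IsSimple.non_abelian (R := ℂ) (L := 𝔤)
    ⟨fun a b => hX.lie_eq_zero (zero_lie a) (zero_lie b)⟩

/-! ### The grading of `𝔤` by eigenspaces of `θ` -/

namespace TorsionAut

variable {𝔤 : Type*} [LieRing 𝔤] [LieAlgebra ℂ 𝔤] [FiniteDimensional ℂ 𝔤]
  [LieAlgebra.IsSimple ℂ 𝔤] (D : TorsionAut 𝔤)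

theorem N_ne_zero : (D.N : ℤ) ≠ 0 :=
  Int.natCast_ne_zero.2 fun h => D.m_pos.ne' (by rw [← D.e_mul_N, h, mul_zero])

theorem ξ_m_zpow_pow (i : ℤ) : (ξ D.m ^ i) ^ D.m = 1 := by
  rw [ξ_zpow, ← Complex.exp_nat_mul, Complex.exp_eq_one_iff]
  refine ⟨i, ?_⟩
  have := D.m_ne_zero
  field_simp

/-- The projection of `𝔤` onto `𝔤ᵢ`. -/
def θProj (i : ℤ) : Module.End ℂ 𝔤 := eigenAverage D.θEnd D.m (ξ D.m ^ i)

theorem θProj_mem (i : ℤ) (v : 𝔤) : D.θProj i v ∈ D.θPiece i :=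
  D.mem_θPiece.2 (map_eigenAverage (pow_orderOf_eq_one _) (D.ξ_m_zpow_pow i)
    (zpow_ne_zero i (ξ_ne_zero _)) v)

theorem θProj_of_mem {i : ℤ} {v : 𝔤} (hv : v ∈ D.θPiece i) : D.θProj i v = v :=
  eigenAverage_of_eigen D.m_pos.ne' (zpow_ne_zero i (ξ_ne_zero _)) (D.mem_θPiece.1 hv)

/-- Since `κ` is `θ`-invariant, `κ(v, ·)` is multiplied by `ξₘ⁻ⁱ` under `θ`, so averaging towards
`𝔤₋ᵢ` does not change its values. -/
theorem killingForm_θProj {i : ℤ} {v : 𝔤} (hv : v ∈ D.θPiece i) (y : 𝔤) :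
    killingForm ℂ 𝔤 v (D.θProj (-i) y) = killingForm ℂ 𝔤 v y := by
  refine functional_eigenAverage D.m_pos.ne' (zpow_ne_zero _ (ξ_ne_zero _)) _ (fun w => ?_) y
  have h := LieAlgebra.killingForm_of_equiv_apply D.θ v w
  rw [D.mem_θPiece.1 hv, map_smul, LinearMap.smul_apply, smul_eq_mul] at h
  rw [← h, zpow_neg, inv_mul_cancel_left₀ (zpow_ne_zero i (ξ_ne_zero _))]
  rfl

/-- The grading `𝔤ᵢ = (Ker (ad X) ∩ 𝔤ᵢ) + [X, 𝔤ᵢ₋₁]`. -/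
theorem exists_ker_add_lie {X : 𝔤} (hX : X ∈ D.θPiece 1) (hreg : IsRegularSemisimple X) {i : ℤ}
    {v : 𝔤} (hv : v ∈ D.θPiece i) :
    ∃ h ∈ D.θPiece i, ∃ w ∈ D.θPiece (i - 1), ⁅X, h⁆ = 0 ∧ v = h + ⁅X, w⁆ := by
  obtain ⟨h, w, hh, hvw⟩ := exists_ker_add_range hreg.1 v
  have hd : ∀ u : 𝔤, ⁅X, ⁅X, u⁆⁆ = 0 → ⁅X, u⁆ = 0 := fun u => disjoint_ker_range hreg.1
  replace hh : ⁅X, h⁆ = 0 := hh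
  replace hvw : v = h + ⁅X, ⁅X, w⁆⁆ := hvw
  have hX' := D.mem_θPiece.1 hX
  rw [zpow_one] at hX'
  set z := ξ D.m with hz
  have hz0 : z ≠ 0 := ξ_ne_zero _
  have hθ : ∀ u : 𝔤, D.θ ⁅X, u⁆ = ⁅X, z • D.θ u⁆ := fun u => by
    rw [LieEquiv.map_lie, hX', smul_lie, lie_smul]
  have hθh : ⁅X, D.θ h⁆ = 0 := by
    have := hθ h
    rw [hh, map_zero, lie_smul] at this
    exact (smul_eq_zero.1 this.symm).resolve_left hz0
  -- `θ v = zⁱ v` written out for the two summands of `v`. The left side is in `Ker (ad X)` and the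
  -- right side in `Im (ad X)`, so both vanish.
  have key : z ^ i • h - D.θ h = ⁅X, z • D.θ ⁅X, w⁆ - z ^ i • ⁅X, w⁆⁆ := by
    have h1 := D.mem_θPiece.1 hv
    rw [hvw, map_add, hθ, ← hz, smul_add] at h1
    rw [lie_sub, lie_smul (z ^ i) X, sub_eq_sub_iff_add_eq_add, ← h1, add_comm]
  have h2 : ⁅X, z • D.θ ⁅X, w⁆ - z ^ i • ⁅X, w⁆⁆ = 0 := by
    apply hd
    rw [← key, lie_sub, lie_smul, hh, hθh, smul_zero, sub_zero]
  -- The argument of `ad X` in `h2` lies in `Im (ad X)`, where `ad X` is injective. So `[X, w]` is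
  -- homogeneous of degree `i - 1`, although `w` need not be; hence it is the witness below.
  have h3 : z • D.θ ⁅X, w⁆ - z ^ i • ⁅X, w⁆ = 0 := by
    rw [hθ, ← lie_smul, ← lie_smul, ← lie_sub] at h2 ⊢
    exact hd _ h2
  refine ⟨h, D.mem_θPiece.2 ?_, ⁅X, w⁆, D.mem_θPiece.2 ?_, hh, hvw⟩
  · rw [h2] at key
    exact (sub_eq_zero.1 key).symm
  · rw [zpow_sub_one₀ hz0, mul_comm, mul_smul, ← sub_eq_zero.1 h3, smul_smul,
      inv_mul_cancel₀ hz0, one_smul]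

/-! ### Transport of the form and the cocycle through `Φ` -/

/-- The monomials `uⁱ ⊗ v`, `v ∈ 𝔤ᵢ`, as elements of `𝔤(θ, m)`. -/
def thetaMono (i : ℤ) : D.θPiece i →ₗ[ℂ] D.thetaLoop :=
  LinearMap.codRestrict D.thetaLoop.toSubmodule (mono i ∘ₗ (D.θPiece i).subtype)
    fun v => mono_mem_loopSub v.2

theorem coe_thetaMono (i : ℤ) (v : D.θPiece i) :
    (D.thetaMono i v : Loop 𝔤) = mono i (v : 𝔤) := rfl

theorem coeff_mem (f : D.thetaLoop) (i : ℤ) : coeff i (f : Loop 𝔤) ∈ D.θPiece i := f.2 i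

theorem eq_sum_thetaMono (f : D.thetaLoop) :
    f = ∑ i ∈ (LieAlgebra.LoopAlgebra.toFinsupp ℂ ℤ 𝔤 (f : Loop 𝔤)).support,
      D.thetaMono i ⟨_, D.coeff_mem f i⟩ := by
  refine Subtype.ext ((eq_sum_mono (f : Loop 𝔤)).trans ?_)
  exact (map_sum D.thetaLoop.toSubmodule.subtype
    (fun i => D.thetaMono i ⟨_, D.coeff_mem f i⟩) _).symm

/-- `Φ` is characterized by `tToU ∘ Φ = adLam`, and both of these maps preserve the form. -/
theorem form_Φ (f g : D.thetaLoop) :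
    D.form (D.Φ f) (D.Φ g) = loopForm (f : Loop 𝔤) (g : Loop 𝔤) := by
  change loopForm (D.Φ f : Loop 𝔤) (D.Φ g : Loop 𝔤) = _
  rw [← loopForm_subst D.N_ne_zero]
  change loopForm (D.tToU (D.Φ f)) (D.tToU (D.Φ g)) = _
  rw [tToU_Φ, tToU_Φ]
  exact loopForm_adCochar _ _ _ _

/-- The factor `N` comes from `t = uᴺ`, which multiplies exponents by `N`; the second term is the
correction for `Ad(λ(u⁻¹))`, with `ε = -1`. -/
theorem loopCocycle_Φ (f g : D.thetaLoop) :
    D.N * loopCocycle (D.Φ f : Loop 𝔤) (D.Φ g : Loop 𝔤) =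
      loopCocycle (f : Loop 𝔤) (g : Loop 𝔤)
        - loopForm (ad ℂ (Loop 𝔤) (mono 0 D.lam) (f : Loop 𝔤)) (g : Loop 𝔤) := by
  have h := loopCocycle_subst D.N_ne_zero (D.Φ f : Loop 𝔤) (D.Φ g : Loop 𝔤)
  rw [Int.cast_natCast] at h
  rw [← h]
  change loopCocycle (D.tToU (D.Φ f)) (D.tToU (D.Φ g)) = _
  rw [tToU_Φ, tToU_Φ]
  refine (loopCocycle_adCochar _ _ _ _).trans ?_
  push_cast
  ring

theorem Φ_thetaMono {i k l : ℤ} (v : D.θPiece i) (hk : (v : 𝔤) ∈ gr D.lam k)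
    (h : i - k = D.N * l) : (D.Φ (D.thetaMono i v) : Loop 𝔤) = mono l (v : 𝔤) := by
  apply D.tToU_injective
  rw [tToU_Φ, coe_thetaMono]
  change adCochar D.iSup_gr (-1) (mono i (v : 𝔤)) = subst (D.N : ℤ) (mono l (v : 𝔤))
  rw [adCochar_mono _ _ _ hk, subst_mono, ← h, neg_one_mul, sub_eq_add_neg]

/-! ### The Kac–Moy–Prasad grading is the grading by `u`-degree -/

/-- As `𝔱` is abelian, `h` lies in `𝔤(0)`, where `θ` and `σ` agree. Consequently `θ` preserves the
weight spaces of `𝔱^σ`. -/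
theorem θ_𝔱σ {h : 𝔤} (hh : h ∈ D.𝔱σ) : D.θ h = h := by
  have h0 : h ∈ gr D.lam 0 := by
    have h1 : ⁅D.x, (⟨h, hh.1⟩ : D.𝔱)⁆ = 0 := trivial_lie_zero _ _ _ _
    have h2 : ⁅(D.x : 𝔤), h⁆ = 0 := congrArg Subtype.val h1
    rw [mem_gr, lam, smul_lie, h2, smul_zero, Int.cast_zero, zero_smul]
  have h3 : D.σ h = (1 : ℂ) • h := Module.End.mem_eigenspace_iff.1 hh.2
  rw [D.θ_gr h0, zpow_zero, one_smul, h3, one_smul]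

/-- The weight space of `𝔤` for `𝔱^σ`, of weight the restriction of `α`. -/
def σWeightSpace (α : LieModule.Weight ℂ D.𝔱 𝔤) : Submodule ℂ 𝔤 where
  carrier := {v | ∀ h : D.𝔱, (h : 𝔤) ∈ D.𝔱σ → ⁅(h : 𝔤), v⁆ = α h • v}
  add_mem' {v w} hv hw h hh := by rw [lie_add, hv h hh, hw h hh, smul_add]
  zero_mem' h _ := by rw [lie_zero, smul_zero]
  smul_mem' c v hv h hh := by rw [lie_smul, hv h hh, smul_comm]

theorem θ_σWeightSpace {α : LieModule.Weight ℂ D.𝔱 𝔤} {v : 𝔤} (hv : v ∈ D.σWeightSpace α) :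
    D.θ v ∈ D.σWeightSpace α := fun h hh => by
  conv_lhs => rw [← D.θ_𝔱σ hh]
  rw [← LieEquiv.map_lie, hv h hh, map_smul]

/-- The weight spaces of `𝔱` span `𝔤` but `θ` may permute them. Each is contained in a weight space
of `𝔱^σ`, which `θ` preserves, so the projection to `𝔤ᵢ` keeps it there. -/
theorem θPiece_le (i : ℤ) : D.θPiece i ≤ ⨆ α, D.θPiece i ⊓ D.σWeightSpace α := by
  have h := LieModule.iSup_genWeightSpace_eq_top' ℂ D.𝔱 𝔤
  rw [← LieSubmodule.toSubmodule_inj, LieSubmodule.iSup_toSubmodule,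
    LieSubmodule.top_toSubmodule] at h
  have h1 : (⨆ α : LieModule.Weight ℂ D.𝔱 𝔤, (rootSpace D.𝔱 α).toSubmodule) ≤
      (⨆ α, D.θPiece i ⊓ D.σWeightSpace α).comap (D.θProj i) := by
    refine iSup_le fun α v hv => Submodule.mem_iSup_of_mem α ⟨D.θProj_mem i v, ?_⟩
    exact eigenAverage_mem (fun w hw => D.θ_σWeightSpace hw) _ _
      fun h _ => lie_eq_smul_of_mem_rootSpace hv h
  rw [h] at h1
  intro v hv
  have h2 := h1 (Submodule.mem_top (x := v))
  rw [Submodule.mem_comap] at h2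
  rwa [D.θProj_of_mem hv] at h2

/-- If `w ∈ 𝔤ᵢ` has `𝔱^σ`-weight `α` and `k = m α(x)`, then `Φ(uⁱ ⊗ w) = tˡ ⊗ w` with `(m / e) l = i
- k`, and `α(x) + l / e = k / m + (i - k) / m = i / m`. -/
theorem Φ_thetaMono_mem_kmp (i : ℤ) (v : D.θPiece i) : D.Φ (D.thetaMono i v) ∈ D.kmp i := by
  let T : Submodule ℂ 𝔤 :=
    ((D.kmp i).comap ((D.Φ : D.thetaLoop →ₗ[ℂ] D.twistedLoop) ∘ₗ D.thetaMono i)).map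
      (D.θPiece i).subtype
  suffices h : (⨆ α, D.θPiece i ⊓ D.σWeightSpace α) ≤ T by
    obtain ⟨w, hw, hwv⟩ := h (D.θPiece_le i v.2)
    rw [← Subtype.ext hwv]
    exact hw
  refine iSup_le fun α w hw => ⟨⟨w, hw.1⟩, ?_, rfl⟩
  change D.Φ (D.thetaMono i ⟨w, hw.1⟩) ∈ D.kmp i
  -- Divisibility of `i - k` by `N` comes from the order of `σ` acting on a nonzero eigenvector, so
  -- `w = 0` is treated apart.
  rcases eq_or_ne w 0 with rfl | hw0
  · have : (⟨0, hw.1⟩ : D.θPiece i) = 0 := rfl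
    rw [this, map_zero, map_zero]
    exact zero_mem _
  obtain ⟨k, hk⟩ := D.weight_int α
  have hgr : w ∈ gr D.lam k := by
    rw [mem_gr, lam, smul_lie, hw.2 D.x D.xσ.2, smul_smul, hk]
  have hσ : D.σ w = ξ D.m ^ (i - k) • w := by
    have h := D.θ_gr hgr
    rw [D.mem_θPiece.1 hw.1] at h
    rw [sub_eq_neg_add, zpow_add₀ (ξ_ne_zero _), mul_smul, h, smul_smul, ← zpow_add₀ (ξ_ne_zero _)]
    simp
  obtain ⟨l, hl⟩ := D.exists_N_mul hw0 hσ
  have hmono := D.Φ_thetaMono ⟨w, hw.1⟩ hgr hl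
  let β : Module.Dual ℂ D.𝔱σ := LieModule.Weight.toLinear ℂ D.𝔱 𝔤 α ∘ₗ
    Submodule.inclusion (inf_le_left : D.𝔱σ ≤ D.𝔱.toSubmodule)
  have hβ : β D.xσ + l / D.e = i / D.m := by
    change α D.x + l / D.e = i / D.m
    have hm := D.m_ne_zero
    have he : (D.e : ℂ) ≠ 0 := Nat.cast_ne_zero.2 D.e_pos.ne'
    have h1 : (D.e : ℂ) * D.N = D.m := by exact_mod_cast D.e_mul_N
    have h2 : (i : ℂ) - k = D.N * l := by exact_mod_cast hl
    field_simp
    linear_combination (D.e : ℂ) * hk - (D.e : ℂ) * h2 - (l : ℂ) * h1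
  refine Submodule.mem_iSup_of_mem β (Submodule.mem_iSup_of_mem l
    (Submodule.mem_iSup_of_mem hβ ⟨fun h j => ?_, fun j => ?_⟩))
  · rw [hmono, coeff_mono]
    split_ifs with hj
    · exact hw.2 ⟨h, h.2.1⟩ h.2
    · rw [lie_zero, smul_zero]
  · rw [hmono, coeff_mono]
    split_ifs with hj
    · rw [hj]
    · rw [smul_zero, smul_zero]

/-- The condition on `(β, n)` says that `λ = m x` acts by `i - N n`. As `σ` acts by `ξₑⁿ = ξₘ^(N
n)`, the product formula for `θ` gives the eigenvalue `ξₘⁱ`. -/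
theorem exists_of_mem_affineWeightSpace {β : Module.Dual ℂ D.𝔱σ} {n i : ℤ}
    (hβ : β D.xσ + n / D.e = i / D.m) {f : D.twistedLoop} (hf : f ∈ D.affineWeightSpace β n) :
    ∃ v, D.Φ (D.thetaMono i v) = f := by
  -- An eigenvector of `t ∂ₜ` for the eigenvalue `n` is a single monomial `tⁿ ⊗ v`.
  have hfn : (f : Loop 𝔤) = mono n (coeff n (f : Loop 𝔤)) := by
    refine eq_mono_of_coeff fun j hj => ?_
    have h := hf.2 j
    rw [← sub_eq_zero, ← sub_smul, ← Int.cast_smul_eq_zsmul ℂ] at h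
    exact (smul_eq_zero.1 h).resolve_left (Int.cast_ne_zero.2 (sub_ne_zero.2 hj))
  set v := coeff n (f : Loop 𝔤)
  have hσ : D.σ v = ξ D.e ^ n • v := D.mem_σPiece.1 (f.2 n)
  have hgr : v ∈ gr D.lam (i - D.N * n) := by
    have h1 : ⁅(D.x : 𝔤), v⁆ = β D.xσ • v := hf.1 D.xσ n
    rw [mem_gr, lam, smul_lie, h1, smul_smul]
    congr 1
    have hm := D.m_ne_zero
    have he : (D.e : ℂ) ≠ 0 := Nat.cast_ne_zero.2 D.e_pos.ne'
    have h2 : (D.e : ℂ) * D.N = D.m := by exact_mod_cast D.e_mul_N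
    rw [eq_sub_of_add_eq hβ]
    push_cast
    field_simp
    linear_combination (n : ℂ) * h2
  have hθ : v ∈ D.θPiece i := by
    rw [mem_θPiece, D.θ_gr hgr, hσ, ξ_e_zpow, smul_smul, ← zpow_add₀ (ξ_ne_zero _),
      sub_add_cancel]
  exact ⟨⟨v, hθ⟩, Subtype.ext ((D.Φ_thetaMono ⟨v, hθ⟩ hgr (by ring)).trans hfn.symm)⟩

theorem kmp_eq (i : ℤ) :
    D.kmp i = LinearMap.range ((D.Φ : D.thetaLoop →ₗ[ℂ] D.twistedLoop) ∘ₗ D.thetaMono i) := by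
  refine le_antisymm ?_ ?_
  · exact iSup_le fun β => iSup_le fun n => iSup_le fun hβ f hf =>
      D.exists_of_mem_affineWeightSpace hβ hf
  · rintro _ ⟨v, rfl⟩
    exact D.Φ_thetaMono_mem_kmp i v

/-! ### Kernel and image of `ad p₁` -/

variable {X : 𝔤} (hX : X ∈ D.θPiece 1)

theorem coe_lie_uX (f : D.thetaLoop) :
    (⁅D.uX hX, f⁆ : D.thetaLoop) = ad ℂ (Loop 𝔤) (mono 1 X) (f : Loop 𝔤) := rfl

theorem exists_Φ_eq (b : D.twistedLoop) : ∃ f, D.Φ f = b :=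
  ⟨D.Φ.symm b, D.Φ.apply_symm_apply b⟩

theorem lie_p₁_Φ (f : D.thetaLoop) : ⁅D.p₁ hX, D.Φ f⁆ = D.Φ ⁅D.uX hX, f⁆ :=
  (LieEquiv.map_lie D.Φ _ _).symm

theorem Φ_mem_𝔞 {f : D.thetaLoop} :
    D.Φ f ∈ D.𝔞 hX ↔ ∀ i, ⁅X, coeff i (f : Loop 𝔤)⁆ = 0 := by
  rw [← ad_mono_eq_zero_iff (i := 1), ← D.coe_lie_uX hX]
  change ⁅D.p₁ hX, D.Φ f⁆ = 0 ↔ _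
  rw [lie_p₁_Φ]
  constructor
  · intro h
    rw [D.Φ.injective (h.trans (map_zero D.Φ).symm)]
    rfl
  · intro h
    rw [show ⁅D.uX hX, f⁆ = 0 from Subtype.ext h, map_zero]

theorem Φ_thetaMono_mem_𝔞 {i : ℤ} {v : D.θPiece i} :
    D.Φ (D.thetaMono i v) ∈ D.𝔞 hX ↔ ⁅X, (v : 𝔤)⁆ = 0 := by
  rw [Φ_mem_𝔞, coe_thetaMono]
  refine ⟨fun h => ?_, fun h j => ?_⟩
  · have := h i
    rwa [coeff_mono, if_pos rfl] at this
  · rw [coeff_mono]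
    split_ifs
    · exact h
    · exact lie_zero X

/-- Disjointness holds in each coefficient by semisimplicity of `ad X`; the sum is everything by the
graded decomposition of each coefficient. -/
theorem isCompl_𝔞_𝔠 (hreg : IsRegularSemisimple X) :
    IsCompl (D.𝔞 hX).toSubmodule (D.𝔠 hX) := by
  constructor
  · rw [Submodule.disjoint_def]
    rintro a ha ⟨b, hb⟩
    obtain ⟨g, rfl⟩ := D.exists_Φ_eq b
    replace hb : ⁅D.p₁ hX, D.Φ g⁆ = a := hb
    rw [lie_p₁_Φ] at hb
    subst hb
    have h1 := (D.Φ_mem_𝔞 hX).1 ha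
    have h2 : ⁅D.uX hX, g⁆ = 0 := by
      refine Subtype.ext (ext_coeff fun i => ?_)
      have h3 := h1 i
      rw [coe_lie_uX, coeff_ad_mono] at h3 ⊢
      exact (disjoint_ker_range hreg.1 h3).trans (map_zero _).symm
    rw [h2, map_zero]
  · rw [codisjoint_iff, Submodule.eq_top_iff']
    intro b
    obtain ⟨f, rfl⟩ := D.exists_Φ_eq b
    rw [D.eq_sum_thetaMono f]
    rw [map_sum]
    refine Submodule.sum_mem _ fun i _ => ?_
    obtain ⟨h, hh, w, hw, hXh, heq⟩ := D.exists_ker_add_lie hX hreg (D.coeff_mem f i)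
    -- The preimage has degree `i - 1` because `ad (uX)` raises the `u`-degree by one.
    refine Submodule.mem_sup.2 ⟨D.Φ (D.thetaMono i ⟨h, hh⟩), (D.Φ_thetaMono_mem_𝔞 hX).2 hXh,
      ⁅D.p₁ hX, D.Φ (D.thetaMono (i - 1) ⟨w, hw⟩)⁆, ⟨_, rfl⟩, ?_⟩
    rw [lie_p₁_Φ, ← map_add]
    refine congrArg D.Φ (Subtype.ext ?_)
    change mono i h + ad ℂ (Loop 𝔤) (mono 1 X) (mono (i - 1) w) = mono i (coeff i (f : Loop 𝔤))
    rw [ad_mono_mono, add_sub_cancel, ← map_add, ← heq]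

/-- Invariance: `⟨a, [p₁, b]⟩ = -⟨[p₁, a], b⟩ = 0`. -/
theorem form_𝔞_𝔠 {a c : D.twistedLoop} (ha : a ∈ D.𝔞 hX) (hc : c ∈ D.𝔠 hX) :
    D.form a c = 0 := by
  obtain ⟨b, rfl⟩ := hc
  obtain ⟨f, rfl⟩ := D.exists_Φ_eq a
  obtain ⟨g, rfl⟩ := D.exists_Φ_eq b
  have h1 : (ad ℂ D.twistedLoop (D.p₁ hX)) (D.Φ g) = D.Φ ⁅D.uX hX, g⁆ := D.lie_p₁_Φ hX g
  have h2 := ad_mono_eq_zero_iff (i := 1).2 ((D.Φ_mem_𝔞 hX).1 ha)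
  rw [h1, form_Φ, coe_lie_uX, ← neg_neg (loopForm _ _), ← loopForm_ad, h2, map_zero,
    LinearMap.zero_apply, neg_zero]

theorem lie_𝔞 (hreg : IsRegularSemisimple X) {a b : D.twistedLoop} (ha : a ∈ D.𝔞 hX)
    (hb : b ∈ D.𝔞 hX) : ⁅a, b⁆ = 0 := by
  obtain ⟨f, rfl⟩ := D.exists_Φ_eq a
  obtain ⟨g, rfl⟩ := D.exists_Φ_eq b
  have h : ⁅f, g⁆ = 0 := Subtype.ext (ad_eq_zero_of_coeff fun i j =>
    hreg.lie_eq_zero ((D.Φ_mem_𝔞 hX).1 ha i) ((D.Φ_mem_𝔞 hX).1 hb j))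
  rw [← LieEquiv.map_lie, h, map_zero]

theorem isLieAbelian_𝔞 (hreg : IsRegularSemisimple X) : IsLieAbelian (D.𝔞 hX) :=
  ⟨fun a b => Subtype.ext (D.lie_𝔞 hX hreg a.2 b.2)⟩

/-! ### The grading of `𝔞` and its pairing -/

theorem exists_of_mem_𝔞Piece {i : ℤ} {a : D.𝔞 hX} (ha : a ∈ D.𝔞Piece hX i) :
    ∃ v : D.θPiece i, ⁅X, (v : 𝔤)⁆ = 0 ∧ D.Φ (D.thetaMono i v) = a := by
  have h : (a : D.twistedLoop) ∈ D.kmp i := ha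
  rw [kmp_eq] at h
  obtain ⟨v, hv⟩ := h
  replace hv : D.Φ (D.thetaMono i v) = a := hv
  exact ⟨v, (D.Φ_thetaMono_mem_𝔞 hX).1 (hv ▸ a.2), hv⟩

/-- The elements `Φ(uⁱ ⊗ v)` of `𝔞ᵢ`, for `v ∈ 𝔤ᵢ` centralizing `X`. -/
def 𝔞Mono {i : ℤ} (v : D.θPiece i) (hv : ⁅X, (v : 𝔤)⁆ = 0) : D.𝔞 hX :=
  ⟨D.Φ (D.thetaMono i v), (D.Φ_thetaMono_mem_𝔞 hX).2 hv⟩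

theorem 𝔞Mono_mem {i : ℤ} (v : D.θPiece i) (hv : ⁅X, (v : 𝔤)⁆ = 0) :
    D.𝔞Mono hX v hv ∈ D.𝔞Piece hX i := D.Φ_thetaMono_mem_kmp i v

theorem isInternal_𝔞Piece : DirectSum.IsInternal (D.𝔞Piece hX) := by
  refine DirectSum.isInternal_submodule_of_iSupIndep_of_iSup_eq_top ?_ ?_
  · refine iSupIndep_of_forall_ne (fun i => coeff i ∘ₗ D.thetaLoop.toSubmodule.subtype ∘ₗ
      (D.Φ.symm : D.twistedLoop →ₗ[ℂ] D.thetaLoop) ∘ₗ (D.𝔞 hX).toSubmodule.subtype) ?_ ?_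
    · intro a ha
      have h1 : D.Φ.symm (a : D.twistedLoop) = 0 :=
        Subtype.ext (ext_coeff fun i => (ha i).trans (map_zero _).symm)
      refine Subtype.ext (D.Φ.symm.injective (h1.trans (map_zero _).symm))
    · intro i a ha j hj
      obtain ⟨v, -, hv⟩ := D.exists_of_mem_𝔞Piece hX ha
      change coeff j (D.Φ.symm (a : D.twistedLoop) : Loop 𝔤) = 0
      rw [← hv, LieEquiv.symm_apply_apply, coe_thetaMono, coeff_mono, if_neg hj.symm]
  · rw [Submodule.eq_top_iff']
    intro a
    obtain ⟨f, hf⟩ := D.exists_Φ_eq (a : D.twistedLoop)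
    -- Every coefficient of `f` centralizes `X`, so each monomial of `f` gives an element of `𝔞` on
    -- its own.
    have hX' := (D.Φ_mem_𝔞 hX (f := f)).1 (hf ▸ a.2)
    have h : a = ∑ i ∈ (LieAlgebra.LoopAlgebra.toFinsupp ℂ ℤ 𝔤 (f : Loop 𝔤)).support,
        D.𝔞Mono hX ⟨_, D.coeff_mem f i⟩ (hX' i) := by
      refine Subtype.ext ?_
      have h1 := map_sum (D.Φ : D.thetaLoop →ₗ[ℂ] D.twistedLoop)
        (fun i => D.thetaMono i ⟨_, D.coeff_mem f i⟩)
        (LieAlgebra.LoopAlgebra.toFinsupp ℂ ℤ 𝔤 (f : Loop 𝔤)).support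
      rw [← D.eq_sum_thetaMono f] at h1
      refine (hf.symm.trans h1).trans ?_
      exact (map_sum (D.𝔞 hX).toSubmodule.subtype
        (fun i => D.𝔞Mono hX ⟨_, D.coeff_mem f i⟩ (hX' i)) _).symm
    rw [h]
    exact Submodule.sum_mem _ fun i _ => Submodule.mem_iSup_of_mem i (D.𝔞Mono_mem hX _ _)

theorem form_Φ_thetaMono {i j : ℤ} (v : D.θPiece i) (w : D.θPiece j) :
    D.form (D.Φ (D.thetaMono i v)) (D.Φ (D.thetaMono j w)) =
      if i + j = 0 then killingForm ℂ 𝔤 (v : 𝔤) (w : 𝔤) else 0 := by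
  rw [form_Φ, coe_thetaMono, coe_thetaMono, loopForm_mono]

theorem form_comm (f g : D.twistedLoop) : D.form f g = D.form g f := by
  have h : (loopForm : LinearMap.BilinForm ℂ (Loop 𝔤)) = LinearMap.flip loopForm := by
    refine bilin_ext_mono (W := fun _ : Unit => ⊤) (by simp) fun i j _ _ v _ w _ => ?_
    rw [LinearMap.flip_apply, loopForm_mono, loopForm_mono, add_comm i j]
    congr 1
    exact LieModule.traceForm_comm ℂ 𝔤 𝔤 v w
  exact LinearMap.congr_fun₂ h (f : Loop 𝔤) (g : Loop 𝔤)

theorem form_𝔞Piece_eq_zero {i j : ℤ} (hij : i + j ≠ 0) {a b : D.𝔞 hX}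
    (ha : a ∈ D.𝔞Piece hX i) (hb : b ∈ D.𝔞Piece hX j) : D.form a b = 0 := by
  obtain ⟨v, -, hv⟩ := D.exists_of_mem_𝔞Piece hX ha
  obtain ⟨w, -, hw⟩ := D.exists_of_mem_𝔞Piece hX hb
  rw [← hv, ← hw, form_Φ_thetaMono, if_neg hij]

/-- To show `κ(v, y) = 0` for every `y`, project `y` to `𝔤₋ᵢ` and split it as `u + [X, w]`. The
hypothesis kills the pairing with `u`, and `κ(v, [X, w]) = -κ([X, v], w) = 0`. -/
theorem eq_zero_of_form_𝔞Piece (hreg : IsRegularSemisimple X) {i j : ℤ} (hij : i + j = 0)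
    {a : D.𝔞 hX} (ha : a ∈ D.𝔞Piece hX i) (h : ∀ b ∈ D.𝔞Piece hX j, D.form a b = 0) :
    a = 0 := by
  obtain rfl : j = -i := by omega
  obtain ⟨v, hXv, hv⟩ := D.exists_of_mem_𝔞Piece hX ha
  have h0 : (v : 𝔤) = 0 := by
    refine (LieAlgebra.IsKilling.killingForm_nondegenerate ℂ 𝔤).1 _ fun y => ?_
    rw [← D.killingForm_θProj v.2]
    obtain ⟨u, hu, w, hw, hXu, heq⟩ := D.exists_ker_add_lie hX hreg (D.θProj_mem (-i) y)
    have h1 := h _ (D.𝔞Mono_mem hX ⟨u, hu⟩ hXu)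
    rw [← hv] at h1
    replace h1 := (D.form_Φ_thetaMono v ⟨u, hu⟩).symm.trans h1
    rw [if_pos hij] at h1
    rw [heq, map_add, h1, zero_add, ← neg_neg (killingForm ℂ 𝔤 _ _), ← killingForm_lie, hXv,
      map_zero, LinearMap.zero_apply, neg_zero]
  refine Subtype.ext (hv.symm.trans ?_)
  rw [show v = 0 from Subtype.ext h0, map_zero, map_zero]
  rfl

/-! ### The central extension of `𝔞` does not split -/

theorem p₁_mem_𝔞 : D.p₁ hX ∈ D.𝔞 hX := lie_self (D.p₁ hX)

theorem p₁_ne_zero (hX0 : X ≠ 0) : D.p₁ hX ≠ 0 := by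
  intro h
  have h1 : D.uX hX = 0 := D.Φ.injective (h.trans (map_zero D.Φ).symm)
  have h2 : coeff 1 (D.uX hX : Loop 𝔤) = X := (coeff_mono 1 1 X).trans (if_pos rfl)
  rw [h1] at h2
  exact hX0 (h2.symm.trans (map_zero _))

/-- For `b = Φ(u⁻¹ ⊗ w)` in `𝔞₋₁` one has `N ω(p₁, b) = κ(X, w) = ⟨p₁, b⟩`. If `ω(p₁, ·)` vanished
on `𝔞`, then `p₁ ∈ 𝔞₁` would be orthogonal to `𝔞₋₁` and hence zero. -/
theorem exists_loopCocycle_ne_zero (hreg : IsRegularSemisimple X) :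
    ∃ b ∈ D.𝔞 hX, loopCocycle (D.p₁ hX : Loop 𝔤) (b : Loop 𝔤) ≠ 0 := by
  by_contra! hcon
  refine D.p₁_ne_zero hX hreg.ne_zero (congrArg Subtype.val
    (D.eq_zero_of_form_𝔞Piece hX hreg (i := 1) (j := -1) (by norm_num)
      (a := ⟨D.p₁ hX, D.p₁_mem_𝔞 hX⟩) (D.Φ_thetaMono_mem_kmp 1 ⟨X, hX⟩) fun b hb => ?_))
  obtain ⟨w, hXw, hw⟩ := D.exists_of_mem_𝔞Piece hX hb
  have h1 := D.loopCocycle_Φ (D.uX hX) (D.thetaMono (-1) w)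
  rw [show D.Φ (D.uX hX) = D.p₁ hX from rfl, hw, hcon b b.2, mul_zero] at h1
  change 0 = loopCocycle (mono 1 X) (mono (-1) (w : 𝔤)) -
    loopForm (ad ℂ (Loop 𝔤) (mono 0 D.lam) (mono 1 X)) (mono (-1) (w : 𝔤)) at h1
  -- The correction term is `κ([λ, X], w) = κ(λ, [X, w])`, which vanishes because `w` centralizes
  -- `X`.
  rw [ad_mono_mono, zero_add, loopCocycle_mono, loopForm_mono, if_pos (by norm_num),
    if_pos (by norm_num), ← lie_skew D.lam X, map_neg, LinearMap.neg_apply, killingForm_lie, hXw,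
    map_zero, neg_zero, neg_zero, sub_zero, Int.cast_one, one_mul] at h1
  rw [← hw]
  change D.form (D.Φ (D.thetaMono 1 ⟨X, hX⟩)) _ = 0
  rw [form_Φ_thetaMono, if_pos (by norm_num), ← h1]

theorem 𝔞Proj_surjective : Function.Surjective (D.𝔞Proj hX) := fun a =>
  ⟨⟨⟨KMExt.mk ((a : D.twistedLoop) : Loop 𝔤) 0, (a : D.twistedLoop).2⟩, a.2⟩, rfl⟩

theorem coe_𝔞Proj (z : D.𝔞Hat hX) : ((D.𝔞Proj hX z : D.twistedLoop) : Loop 𝔤) =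
    KMExt.proj 𝔤 ((z : D.twistedKM) : KMExt 𝔤) := rfl

theorem 𝔞Proj_eq_zero_iff (z : D.𝔞Hat hX) :
    D.𝔞Proj hX z = 0 ↔ ∃ c : ℂ, (z : D.twistedKM) = c • D.K := by
  constructor
  · intro h
    obtain ⟨c, hc⟩ := KMExt.eq_mk ((z : D.twistedKM) : KMExt 𝔤)
    rw [← D.coe_𝔞Proj hX, h] at hc
    exact ⟨c, Subtype.ext (hc.trans (KMExt.smul_K c).symm)⟩
  · rintro ⟨c, hc⟩
    refine Subtype.ext (Subtype.ext ?_)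
    rw [coe_𝔞Proj, hc]
    exact smul_zero c

theorem lie_eq_zero_of_𝔞Proj (z w : D.𝔞Hat hX) (hz : D.𝔞Proj hX z = 0) : ⁅z, w⁆ = 0 := by
  refine Subtype.ext (Subtype.ext ?_)
  change ⁅((z : D.twistedKM) : KMExt 𝔤), ((w : D.twistedKM) : KMExt 𝔤)⁆ = 0
  obtain ⟨c, hc⟩ := KMExt.eq_mk ((z : D.twistedKM) : KMExt 𝔤)
  obtain ⟨d, hd⟩ := KMExt.eq_mk ((w : D.twistedKM) : KMExt 𝔤)
  rw [← D.coe_𝔞Proj hX, hz] at hc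
  rw [hc, hd, KMExt.lie_mk]
  have h1 : ⁅(((0 : D.𝔞 hX) : D.twistedLoop) : Loop 𝔤), KMExt.proj 𝔤 (w : D.twistedKM)⁆ = 0 :=
    zero_lie (L := Loop 𝔤) (M := Loop 𝔤) _
  have h2 : loopCocycle (((0 : D.𝔞 hX) : D.twistedLoop) : Loop 𝔤)
      (KMExt.proj 𝔤 (w : D.twistedKM)) = 0 := by
    change loopCocycle 0 _ = 0
    rw [map_zero, LinearMap.zero_apply]
  rw [h1, h2]
  rfl

/-- A section sends commuting elements to commuting lifts, but lifts of `a` and `b` in `𝔞` have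
bracket `ω(a, b) K`, which is nonzero for `a = p₁` and a suitable `b`. -/
theorem not_exists_section (hreg : IsRegularSemisimple X) :
    ¬ ∃ s : D.𝔞 hX →ₗ⁅ℂ⁆ D.𝔞Hat hX, (D.𝔞Proj hX).comp s = LieHom.id := by
  rintro ⟨s, hs⟩
  obtain ⟨b, hb, hne⟩ := D.exists_loopCocycle_ne_zero hX hreg
  apply hne
  let a' : D.𝔞 hX := ⟨D.p₁ hX, D.p₁_mem_𝔞 hX⟩
  let b' : D.𝔞 hX := ⟨b, hb⟩
  have hs' : ∀ c : D.𝔞 hX, D.𝔞Proj hX (s c) = c := fun c => LieHom.congr_fun hs c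
  have h0 : ⁅s a', s b'⁆ = 0 := by
    rw [← LieHom.map_lie, show ⁅a', b'⁆ = 0 from Subtype.ext (D.lie_𝔞 hX hreg a'.2 b'.2), map_zero]
  have h1 : ⁅((s a' : D.twistedKM) : KMExt 𝔤), ((s b' : D.twistedKM) : KMExt 𝔤)⁆ = KMExt.mk 0 0 :=
    congrArg (fun z : D.𝔞Hat hX => ((z : D.twistedKM) : KMExt 𝔤)) h0
  obtain ⟨c, hc⟩ := KMExt.eq_mk ((s a' : D.twistedKM) : KMExt 𝔤)
  obtain ⟨d, hd⟩ := KMExt.eq_mk ((s b' : D.twistedKM) : KMExt 𝔤)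
  rw [← D.coe_𝔞Proj hX, hs'] at hc hd
  rw [hc, hd, KMExt.lie_mk] at h1
  exact (KMExt.mk_injective h1).2

end TorsionAut

end KacLoop

end

theorem mainTheorem3 {𝔤 : Type*} [LieRing 𝔤] [LieAlgebra ℂ 𝔤] [FiniteDimensional ℂ 𝔤]
    [LieAlgebra.IsSimple ℂ 𝔤] (D : KacLoop.TorsionAut 𝔤) (X : 𝔤) (hX : X ∈ D.θPiece 1)
    (hreg : KacLoop.IsRegularSemisimple X) :
    -- orthogonal decomposition
    (IsCompl (D.𝔞 hX).toSubmodule (D.𝔠 hX) ∧ ∀ a ∈ D.𝔞 hX, ∀ c ∈ D.𝔠 hX, D.form a c = 0) ∧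
    -- commutativity and the grading of `𝔞`
    (IsLieAbelian (D.𝔞 hX) ∧
      DirectSum.IsInternal (D.𝔞Piece hX) ∧
      (∀ i j : ℤ, i + j ≠ 0 → ∀ a ∈ D.𝔞Piece hX i, ∀ b ∈ D.𝔞Piece hX j, D.form a b = 0) ∧
      (∀ i j : ℤ, i + j = 0 →
        (∀ a ∈ D.𝔞Piece hX i, (∀ b ∈ D.𝔞Piece hX j, D.form a b = 0) → a = 0) ∧
        (∀ b ∈ D.𝔞Piece hX j, (∀ a ∈ D.𝔞Piece hX i, D.form a b = 0) → b = 0))) ∧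
    -- the pre-image of `𝔞` is a central extension of `𝔞` by `ℂ K`, and it does not split
    (Function.Surjective (D.𝔞Proj hX) ∧
      (∀ z : D.𝔞Hat hX, D.𝔞Proj hX z = 0 ↔ ∃ c : ℂ, (z : D.twistedKM) = c • D.K) ∧
      (∀ z w : D.𝔞Hat hX, D.𝔞Proj hX z = 0 → ⁅z, w⁆ = 0) ∧
      ¬ ∃ s : D.𝔞 hX →ₗ⁅ℂ⁆ D.𝔞Hat hX, (D.𝔞Proj hX).comp s = LieHom.id) := by
  exact ⟨⟨D.isCompl_𝔞_𝔠 hX hreg, fun _ ha _ hc => D.form_𝔞_𝔠 hX ha hc⟩,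
    ⟨D.isLieAbelian_𝔞 hX hreg, D.isInternal_𝔞Piece hX,
      fun _ _ hij _ ha _ hb => D.form_𝔞Piece_eq_zero hX hij ha hb,
      fun i j hij => ⟨fun _ ha h => D.eq_zero_of_form_𝔞Piece hX hreg hij ha h,
        fun b hb h => D.eq_zero_of_form_𝔞Piece hX hreg ((add_comm j i).trans hij) hb
          fun a ha => (D.form_comm _ _).trans (h a ha)⟩⟩,
    ⟨D.𝔞Proj_surjective hX, D.𝔞Proj_eq_zero_iff hX, D.lie_eq_zero_of_𝔞Proj hX,
      D.not_exists_section hX hreg⟩⟩
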